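/- Let $n\ge 3$ be an integer and let $(X,Y)=(X(k),Y(k))_{k\ge 0}$ be the random walk on the quarter plane which, from any point of $E=\{(i,j)\in\mathbb Z^2: i\ge 1,\ j\ge 1\}$, jumps by $(1,0),(-1,0),(1,-1),(-1,1)$ with probabilities $$p_{1,0}=p_{-1,0}=\tfrac12\sin(\pi/n)^2,\qquad p_{1,-1}=p_{-1,1}=\tfrac12\cos(\pi/n)^2,$$ and which is killed (absorbed) when it reaches one of the axes $\{i=0\}$, $\{j=0\}$. For $x,y\in E$ let $G^x_y=\mathbb E_x\big[\sum_{k\ge 0}\mathbf 1_{\{(X(k),Y(k))=y\}}\big]$ be its Green functions and, for a reference state $x_0\in E$, let $k^x_y=G^x_y/G^{x_0}_y$ be the Martin kernels. The Martin compactification of the (discrete) space $E$ is the smallest compactification of $E$ to which all the functions $y\mapsto k^x_y$, $x\in E$, extend continuously. A function $h:E\to\mathbb R$ is harmonic for the killed process if $h(x)=\sum_{s}p_s\,h(x+s)$ for all $x\in E$, where $h$ is taken to be $0$ on the axes. Put $z_0=-e^{-\imath\pi/n}$ and $$x(z)=\frac{(z+z_0)(z+\overline{z_0})}{(z-z_0)(z-\overline{z_0})},\qquad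 y(z)=\frac{(z+z_0)^2}{(z-z_0)^2},$$ let $\kappa_p(i,j)$ be the coefficient of $z^p$ in the Taylor expansion at $0$ of $x(z)^{i}y(z)^{j}$, and set $$f_n(i,j)=n\,\frac{\kappa_n(i,j)-\overline{\kappa_n(i,j)}}{(-1)^n\,\imath}\in\mathbb R .$$ Then $0<G^x_y<\infty$ for all $x,y\in E$, and for every reference state $x_0\in E$ the Martin compactification of $E$ is the one-point compactification $E\cup\{\infty\}$. Moreover $f_n$ is, up to a positive multiplicative constant, the unique positive harmonic function of the killed process: $f_n$ is harmonic for the killed process and $f_n>0$ on $E$, and every nonnegative harmonic function $h$ that is not identically zero (in particular every positive harmonic function) is of the form $h=c f_n$ for a constant $c>0$. -/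

import Mathlib

open MeasureTheory ProbabilityTheory

noncomputable section

namespace KilledWalk

/-- The interior `{(i, j) : i ≥ 1, j ≥ 1}` of the quarter plane, i.e. the state space of the walk
killed at the axes. As a type it carries the discrete topology. -/
def quadrant : Set (ℤ × ℤ) := {z | 1 ≤ z.1 ∧ 1 ≤ z.2}

/-- The four possible jumps. -/
def steps : Finset (ℤ × ℤ) := {(1, 0), (-1, 0), (1, -1), (-1, 1)}

/-- The jump probabilities: `p(1,0) = p(-1,0) = sin(π/n)²/2`, `p(1,-1) = p(-1,1) = cos(π/n)²/2`,
and `0` for any other jump. -/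
def stepProb (n : ℕ) (s : ℤ × ℤ) : ℝ :=
  if s = (1, 0) ∨ s = (-1, 0) then Real.sin (Real.pi / n) ^ 2 / 2
  else if s = (1, -1) ∨ s = (-1, 1) then Real.cos (Real.pi / n) ^ 2 / 2
  else 0

/-- The law of one jump. -/
def stepLaw (n : ℕ) : Measure (ℤ × ℤ) :=
  ∑ s ∈ steps, ENNReal.ofReal (stepProb n s) • Measure.dirac s

instance stepLaw_isProbabilityMeasure (n : ℕ) : IsProbabilityMeasure (stepLaw n) := by
  constructor
  have h1 : 0 ≤ Real.sin (Real.pi / n) ^ 2 / 2 := by positivity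
  have h2 : 0 ≤ Real.cos (Real.pi / n) ^ 2 / 2 := by positivity
  have h3 := Real.sin_sq_add_cos_sq (Real.pi / n)
  simp only [stepLaw, steps, stepProb, Measure.coe_finsetSum, Measure.coe_smul, Finset.sum_apply,
    Pi.smul_apply, measure_univ, smul_eq_mul, mul_one]
  rw [← ENNReal.ofReal_sum_of_nonneg]
  · rw [← ENNReal.ofReal_one]
    congr 1
    simp
    linarith
  · intro s _
    split_ifs <;> first | assumption | exact le_rfl

/-- The law of a sequence of i.i.d. jumps. -/
def jumpsLaw (n : ℕ) : Measure (ℕ → ℤ × ℤ) := Measure.infinitePi fun _ => stepLaw n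

open Classical in
/-- The position at time `k` of the walk started at `x` with jumps `ω 0, ω 1, …`: it moves
homogeneously inside the quadrant, and is frozen as soon as it has left it (absorption). -/
def walk (x : ℤ × ℤ) (ω : ℕ → ℤ × ℤ) : ℕ → ℤ × ℤ
  | 0 => x
  | k + 1 => if walk x ω k ∈ quadrant then walk x ω k + ω k else walk x ω k

open Classical in
/-- The Green function `G^x_y`: the expected number of visits to `y` of the walk started at `x`. -/
def green (n : ℕ) (x y : quadrant) : ENNReal :=
  ∫⁻ ω, ∑' k : ℕ, (if walk (x : ℤ × ℤ) ω k = (y : ℤ × ℤ) then 1 else 0) ∂(jumpsLaw n)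

/-- The Martin kernel `k^x_y = G^x_y / G^{x₀}_y` with reference state `x₀`. -/
def martinKernel (n : ℕ) (x₀ x y : quadrant) : ℝ :=
  (green n x y).toReal / (green n x₀ y).toReal

/-- `(K, ι)` is a compactification of the discrete space `quadrant` to which all the Martin
kernels `y ↦ k^x_y` extend continuously. -/
structure IsKernelCompactification (n : ℕ) (x₀ : quadrant) (K : Type) [TopologicalSpace K]
    (ι : quadrant → K) : Prop where
  compact : CompactSpace K
  hausdorff : T2Space K
  isDenseEmbedding : IsDenseEmbedding ι
  extend : ∀ x : quadrant, ∃ F : K → ℝ, Continuous F ∧ ∀ y : quadrant, F (ι y) = martinKernel n x₀ x y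

/-- `(K, ι)` is the Martin compactification: the smallest compactification to which the Martin
kernels extend continuously, i.e. any other one maps continuously to it over `quadrant`.
(Quantifying over `Type` loses nothing: as `quadrant` is countable, each of its Hausdorff
compactifications has at most `2 ^ 2 ^ ℵ₀` points.) -/
structure IsMartinCompactification (n : ℕ) (x₀ : quadrant) (K : Type) [TopologicalSpace K]
    (ι : quadrant → K) : Prop extends IsKernelCompactification n x₀ K ι where
  smallest : ∀ (K' : Type) [TopologicalSpace K'] (ι' : quadrant → K'),
    IsKernelCompactification n x₀ K' ι' →
      ∃ π : K' → K, Continuous π ∧ ∀ y : quadrant, π (ι' y) = ι y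

open Classical in
/-- Extension by zero outside of the quadrant. -/
def extendZero (h : quadrant → ℝ) (z : ℤ × ℤ) : ℝ :=
  if hz : z ∈ quadrant then h ⟨z, hz⟩ else 0

/-- `h` is harmonic for the killed walk: `h(x) = ∑ₛ p(s) h(x + s)`, where `h` is `0` at the points
where the walk is killed. -/
def IsHarmonic (n : ℕ) (h : quadrant → ℝ) : Prop :=
  ∀ x : quadrant, h x = ∑ s ∈ steps, stepProb n s * extendZero h ((x : ℤ × ℤ) + s)

/-- `z₀ = -exp(-iπ/n)`. -/
def z₀ (n : ℕ) : ℂ := -Complex.exp (-(Complex.I * Real.pi / n))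

/-- The coordinate `x(z)` of the uniformization. -/
def xFun (n : ℕ) (z : ℂ) : ℂ :=
  (z + z₀ n) * (z + starRingEnd ℂ (z₀ n)) / ((z - z₀ n) * (z - starRingEnd ℂ (z₀ n)))

/-- The coordinate `y(z)` of the uniformization. -/
def yFun (n : ℕ) (z : ℂ) : ℂ := (z + z₀ n) ^ 2 / (z - z₀ n) ^ 2

/-- `κ_p(i, j)`: the coefficient of `z ^ p` in the expansion at `0` of `x(z)^i y(z)^j`. -/
def kappa (n p : ℕ) (w : ℤ × ℤ) : ℂ :=
  iteratedDeriv p (fun z : ℂ => xFun n z ^ w.1 * yFun n z ^ w.2) 0 / (p.factorial : ℂ)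

/-- `f_n = n (κ_n - conj κ_n) / ((-1)^n i)`. This complex number is real, hence equal to its real
part. -/
def f (n : ℕ) (w : ℤ × ℤ) : ℝ :=
  ((n : ℂ) * (kappa n n w - starRingEnd ℂ (kappa n n w)) / ((-1) ^ n * Complex.I)).re

end KilledWalk

end

/-!
The transition operator of the killed walk is symmetric, its Green functions are bounded because the
first coordinate alone is a simple random walk killed at `0`, and a limit of Martin kernels
`k^x_y` as `y` leaves all finite sets is harmonic in `x`, because the Green function with target `y`
is harmonic off `y`. So everything reduces to one fact: the positive harmonic functions of the
killed walk are the multiples of `f n` (`IsProfile.eq_of_nonneg`). Its proof has three ingredients.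

* *The profile.* On the curve parametrized by `x(z)` and `y(z)` the kernel of the walk vanishes, so
  that `f n` is harmonic. With `d_k(m)` the coefficient of `u ^ k` in `((1 + u) / (1 - u)) ^ m`,
  `f n (i, j)` is `2 n` times the sum of `d_k(i + 2 j) d_l(i) sin ((k - l) π / n)` over `k + l = n`
  (`f_eq_sineSum`). The array `d` is totally positive (`cayleyCoeff_mul_le`); this makes `f n`
  positive, of order at least `i j (i + j) ^ (n - 2)` and at most `min i j * (i + j) ^ (n - 1)`.

* *Comparison.* By the maximum principle with quadratic barriers along the axes, a function which is
  subharmonic in the triangle `i + j < 2 R`, at most `0` on the axes and at most `M` on the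
  hypotenuse, is `O(M f / R ^ n)` on the smaller triangle `i + j ≤ R`
  (`IsProfile.le_of_subharmonic`). If `h` is a positive harmonic function that increases in both
  coordinates, this shows first that `h` grows like `R ^ n` along the diagonal and then, applied to
  `f - κ h`, that `f ≤ κ h` (`IsProfile.le_of_monotone`).

* *Monotonicity.* Let `h` be a minimal positive harmonic function. For `s` in the quarter plane, the
  translate `h (· + s)` is superharmonic for the killed walk and at most a multiple of `h`, so that
  its greatest harmonic minorant is `Λ(s) h`. The map `Λ` is multiplicative, and harmonicity of `h`
  turns into `∑ p(s) Λ(s) = 1`; the walk having no drift, this forces `Λ = 1`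
  (`IsMinimal.monotone`). Hence `h (· + s) ≥ h`.

By the comparison, a minimal `h` dominates `f`, hence is proportional to it, and the Krein–Milman
theorem extends this to all positive harmonic functions.
-/

noncomputable section

namespace KilledWalk

/-! ### The averaging operator, the maximum principle and the Harnack inequality -/

/-- The mean of `u` over the four neighbours of `z`, with weight `a` on `z ± (1, 0)` and weight
`b` on `z ± (1, -1)`. -/
def nbrAvg (a b : ℝ) (u : ℤ × ℤ → ℝ) (z : ℤ × ℤ) : ℝ :=
  a * u (z.1 + 1, z.2) + a * u (z.1 - 1, z.2) + b * u (z.1 + 1, z.2 - 1) + b * u (z.1 - 1, z.2 + 1)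

/-- Maximum principle: a function which is superharmonic on a finite set and nonnegative at the
outer neighbours of that set is nonnegative on it. The points `w` in `hbd` include all neighbours
of `z`. -/
lemma nonneg_of_superharmonic {a b : ℝ} (ha : 0 < a) (hb : 0 < b) (hab : 2 * a + 2 * b = 1)
    {S : Set (ℤ × ℤ)} (hS : S.Finite) {u : ℤ × ℤ → ℝ} (hsup : ∀ z ∈ S, nbrAvg a b u z ≤ u z)
    (hbd : ∀ z ∈ S, ∀ w : ℤ × ℤ, w.1 ≤ z.1 + 1 → z.1 ≤ w.1 + 1 → w.2 ≤ z.2 + 1 → z.2 ≤ w.2 + 1 →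
      w.1 + w.2 ≤ z.1 + z.2 + 1 → z.1 + z.2 ≤ w.1 + w.2 + 1 → w ∉ S → 0 ≤ u w) :
    ∀ z ∈ S, 0 ≤ u z := by
  by_contra! hcon
  obtain ⟨z₁, hz₁, hneg⟩ := hcon
  obtain ⟨z₂, hz₂, hmin⟩ := hS.exists_minimalFor u S ⟨z₁, hz₁⟩ |>.imp fun z hz =>
    And.intro hz.1 fun w (hw : w ∈ S) => (le_total (u z) (u w)).elim id fun h => hz.2 hw h
  have hm : u z₂ < 0 := (hmin z₁ hz₁).trans_lt hneg
  -- among the minimizers, one with the largest first coordinate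
  have hfin : {z ∈ S | u z = u z₂}.Finite := hS.subset fun z hz => hz.1
  obtain ⟨z, hz, hmax⟩ := hfin.exists_maximalFor Prod.fst _ ⟨z₂, hz₂, rfl⟩ |>.imp fun z hz =>
    And.intro hz.1 fun w (hw : w ∈ {z ∈ S | u z = u z₂}) =>
      (le_total w.1 z.1).elim id fun h => hz.2 hw h
  have hge : ∀ w : ℤ × ℤ, w.1 ≤ z.1 + 1 → z.1 ≤ w.1 + 1 → w.2 ≤ z.2 + 1 → z.2 ≤ w.2 + 1 →
      w.1 + w.2 ≤ z.1 + z.2 + 1 → z.1 + z.2 ≤ w.1 + w.2 + 1 → u z₂ ≤ u w := by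
    intro w h1 h2 h3 h4 h5 h6
    by_cases hw : w ∈ S
    · exact hmin w hw
    · exact hm.le.trans (hbd z hz.1 w h1 h2 h3 h4 h5 h6 hw)
  have e2 := hge (z.1 - 1, z.2) (by dsimp only; omega) (by dsimp only; omega)
    (by dsimp only; omega) (by dsimp only; omega) (by dsimp only; omega)
    (by dsimp only; omega)
  have e3 := hge (z.1 + 1, z.2 - 1) (by dsimp only; omega) (by dsimp only; omega)
    (by dsimp only; omega) (by dsimp only; omega) (by dsimp only; omega) (by dsimp only; omega)
  have e4 := hge (z.1 - 1, z.2 + 1) (by dsimp only; omega) (by dsimp only; omega)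
    (by dsimp only; omega) (by dsimp only; omega) (by dsimp only; omega) (by dsimp only; omega)
  have h1 : u z₂ < u (z.1 + 1, z.2) := by
    by_cases hw : (z.1 + 1, z.2) ∈ S
    · refine lt_of_le_of_ne (hmin _ hw) fun h => ?_
      have := hmax _ ⟨hw, h.symm⟩
      simp at this
    · exact hm.trans_le (hbd z hz.1 _ (by dsimp only; omega) (by dsimp only; omega)
        (by dsimp only; omega) (by dsimp only; omega) (by dsimp only; omega)
        (by dsimp only; omega) hw)
  have key := hsup z hz.1
  rw [hz.2, nbrAvg] at key
  nlinarith [mul_lt_mul_of_pos_left h1 ha, mul_le_mul_of_nonneg_left e2 ha.le,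
    mul_le_mul_of_nonneg_left e3 hb.le, mul_le_mul_of_nonneg_left e4 hb.le]

/-- Positive superharmonic functions: nonnegative everywhere and at least equal to
their neighbour average in the quadrant. -/
def IsPosSuper (a b : ℝ) (u : ℤ × ℤ → ℝ) : Prop :=
  (∀ z, 0 ≤ u z) ∧ ∀ z ∈ quadrant, nbrAvg a b u z ≤ u z

section Harnack
variable {a b : ℝ} {u : ℤ × ℤ → ℝ}

lemma IsPosSuper.right (ha : 0 < a) (hb : 0 < b) (hu : IsPosSuper a b u) {i j : ℤ} (hi : 1 ≤ i)
    (hj : 1 ≤ j) : a * u (i + 1, j) ≤ u (i, j) := by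
  have h := hu.2 (i, j) ⟨hi, hj⟩
  simp only [nbrAvg] at h
  nlinarith [mul_nonneg ha.le (hu.1 (i - 1, j)), mul_nonneg hb.le (hu.1 (i + 1, j - 1)),
    mul_nonneg hb.le (hu.1 (i - 1, j + 1))]

lemma IsPosSuper.left (ha : 0 < a) (hb : 0 < b) (hu : IsPosSuper a b u) {i j : ℤ} (hi : 1 ≤ i)
    (hj : 1 ≤ j) : a * u (i, j) ≤ u (i + 1, j) := by
  have h := hu.2 (i + 1, j) ⟨by dsimp only; omega, hj⟩
  simp only [nbrAvg, add_sub_cancel_right] at h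
  nlinarith [mul_nonneg ha.le (hu.1 (i + 1 + 1, j)), mul_nonneg hb.le (hu.1 (i + 1 + 1, j - 1)),
    mul_nonneg hb.le (hu.1 (i, j + 1))]

lemma IsPosSuper.up (ha : 0 < a) (hb : 0 < b) (hu : IsPosSuper a b u) {i j : ℤ} (hi : 1 ≤ i)
    (hj : 1 ≤ j) : a * b * u (i, j + 1) ≤ u (i, j) := by
  have h := hu.2 (i + 1, j) ⟨by dsimp only; omega, hj⟩
  simp only [nbrAvg, add_sub_cancel_right] at h
  have h' : b * u (i, j + 1) ≤ u (i + 1, j) := by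
    nlinarith [mul_nonneg ha.le (hu.1 (i + 1 + 1, j)), mul_nonneg hb.le (hu.1 (i + 1 + 1, j - 1)),
      mul_nonneg ha.le (hu.1 (i, j))]
  nlinarith [hu.right ha hb hi hj, mul_le_mul_of_nonneg_left h' ha.le]

lemma IsPosSuper.down (ha : 0 < a) (hb : 0 < b) (hu : IsPosSuper a b u) {i j : ℤ} (hi : 1 ≤ i)
    (hj : 1 ≤ j) : a * b * u (i, j) ≤ u (i, j + 1) := by
  have h := hu.2 (i, j + 1) ⟨hi, by dsimp only; omega⟩
  simp only [nbrAvg, add_sub_cancel_right] at h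
  have h' : b * u (i + 1, j) ≤ u (i, j + 1) := by
    nlinarith [mul_nonneg ha.le (hu.1 (i + 1, j + 1)), mul_nonneg hb.le (hu.1 (i - 1, j + 1 + 1)),
      mul_nonneg ha.le (hu.1 (i - 1, j + 1))]
  nlinarith [hu.left ha hb hi hj, mul_le_mul_of_nonneg_left (hu.left ha hb hi hj) hb.le]

lemma IsPosSuper.shift_le (ha : 0 < a) (hb : 0 < b) (hu : IsPosSuper a b u) {i j : ℤ} (hi : 1 ≤ i)
    (hj : 1 ≤ j) (s t : ℕ) : a ^ s * (a * b) ^ t * u (i + s, j + t) ≤ u (i, j) := by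
  induction s with
  | zero =>
    induction t with
    | zero => simp
    | succ t ih =>
      refine le_trans ?_ ih
      have := mul_le_mul_of_nonneg_left (hu.up ha hb (i := i) (j := j + t) hi (by omega))
        (by positivity : 0 ≤ (a * b) ^ t)
      simp only [Nat.cast_zero, add_zero, pow_zero, one_mul, Nat.cast_succ] at this ⊢
      rw [← add_assoc, pow_succ]
      linarith
  | succ s ih =>
    refine le_trans ?_ ih
    have := mul_le_mul_of_nonneg_left (hu.right ha hb (i := i + s) (j := j + t) (by omega) (by omega))
      (by positivity : 0 ≤ a ^ s * (a * b) ^ t)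
    rw [Nat.cast_succ, ← add_assoc, pow_succ]
    linarith

lemma IsPosSuper.le_shift (ha : 0 < a) (hb : 0 < b) (hu : IsPosSuper a b u) {i j : ℤ} (hi : 1 ≤ i)
    (hj : 1 ≤ j) (s t : ℕ) : a ^ s * (a * b) ^ t * u (i, j) ≤ u (i + s, j + t) := by
  induction s with
  | zero =>
    induction t with
    | zero => simp
    | succ t ih =>
      have := hu.down ha hb (i := i) (j := j + t) hi (by omega)
      have h2 := mul_le_mul_of_nonneg_left ih (by positivity : 0 ≤ a * b)
      simp only [Nat.cast_zero, add_zero, pow_zero, one_mul, Nat.cast_succ] at this h2 ⊢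
      rw [← add_assoc, pow_succ]
      linarith
  | succ s ih =>
    have := hu.left ha hb (i := i + s) (j := j + t) (by omega) (by omega)
    have h2 := mul_le_mul_of_nonneg_left ih ha.le
    rw [Nat.cast_succ, ← add_assoc, pow_succ]
    linarith

/-- Harnack inequality: the values of positive superharmonic functions at two points of the
quadrant are comparable, with a constant which does not depend on the function. -/
lemma exists_harnack (ha : 0 < a) (hb : 0 < b) {z w : ℤ × ℤ} (hz : z ∈ quadrant)
    (hw : w ∈ quadrant) : ∃ c : ℝ, 0 < c ∧ ∀ u, IsPosSuper a b u → c * u w ≤ u z := by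
  obtain ⟨i, j⟩ := z
  obtain ⟨k, l⟩ := w
  obtain ⟨hi, hj⟩ := hz
  obtain ⟨hk, hl⟩ := hw
  simp only at hi hj hk hl
  obtain ⟨s, rfl⟩ := Int.le.dest hi
  obtain ⟨t, rfl⟩ := Int.le.dest hj
  obtain ⟨s', rfl⟩ := Int.le.dest hk
  obtain ⟨t', rfl⟩ := Int.le.dest hl
  refine ⟨a ^ s * (a * b) ^ t * (a ^ s' * (a * b) ^ t'), by positivity, fun u hu => ?_⟩
  have h1 := hu.le_shift ha hb le_rfl le_rfl s t
  have h2 := hu.shift_le ha hb le_rfl le_rfl s' t'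
  have h3 := mul_le_mul_of_nonneg_left h2 (by positivity : 0 ≤ a ^ s * (a * b) ^ t)
  linarith

end Harnack

/-! ### Comparison with a harmonic profile -/

/-- `F` is a harmonic function of the killed walk which vanishes off the quadrant and which, up to
constants, lies between `i j (i + j) ^ N` and `min i j * (i + j) ^ (N + 1)`. -/
structure IsProfile (a b : ℝ) (N : ℕ) (c C : ℝ) (F : ℤ × ℤ → ℝ) : Prop where
  zero : ∀ z ∉ quadrant, F z = 0
  harmonic : ∀ z ∈ quadrant, nbrAvg a b F z = F z
  c_pos : 0 < c
  C_pos : 0 < C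
  lower : ∀ z ∈ quadrant, c * (z.1 * z.2 * (z.1 + z.2) ^ N) ≤ F z
  upper_left : ∀ z ∈ quadrant, F z ≤ C * (z.1 * (z.1 + z.2) ^ (N + 1))
  upper_right : ∀ z ∈ quadrant, F z ≤ C * (z.2 * (z.1 + z.2) ^ (N + 1))

lemma finite_triangle (m : ℤ) : {z : ℤ × ℤ | z ∈ quadrant ∧ z.1 + z.2 < m}.Finite := by
  refine (Set.finite_Icc ((1, 1) : ℤ × ℤ) (m, m)).subset ?_
  rintro ⟨i, j⟩ ⟨⟨h1, h2⟩, h3⟩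
  simp only [Set.mem_Icc, Prod.mk_le_mk] at *
  omega

section Barrier
variable {a b M K : ℝ} {u : ℤ × ℤ → ℝ} {R : ℕ}

/-- A function which is subharmonic in a triangle of size `2 R`, at most `0` off the quadrant and
at most `M`, is at most `K M j / R` in the middle of the side `j = 0`. -/
lemma le_barrier_bottom (ha : 0 < a) (hb : 0 < b) (hab : 2 * a + 2 * b = 1) (hK : K * b = 8)
    (hR : 2 ≤ R) (hM : 0 ≤ M)
    (hsub : ∀ z ∈ quadrant, z.1 + z.2 < 2 * R → u z ≤ nbrAvg a b u z)
    (hout : ∀ z ∉ quadrant, u z ≤ 0) (hle : ∀ z ∈ quadrant, z.1 + z.2 ≤ 2 * R → u z ≤ M)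
    {i j : ℤ} (hj : 1 ≤ j) (hij : i + j = R) (hi : (R : ℤ) ≤ 2 * i) :
    R ^ 2 * u (i, j) ≤ M * ((K + 4) * R * j) := by
  have hK0 : 0 < K := by by_contra! h; nlinarith
  have hR' : (2 : ℝ) ≤ R := by exact_mod_cast hR
  by_cases hjR : 4 * j < R
  · set S : Set (ℤ × ℤ) := {z | 1 ≤ z.2 ∧ 4 * z.2 < R ∧ 4 * (z.1 - i) < R ∧ 4 * (i - z.1) < R}
    have hS : S.Finite := by
      refine (Set.finite_Icc ((i - R, 1) : ℤ × ℤ) (i + R, R)).subset ?_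
      rintro ⟨k, l⟩ ⟨h1, h2, h3, h4⟩
      simp only [Set.mem_Icc, Prod.mk_le_mk] at *
      omega
    -- the paraboloid is steeper in the normal direction, which makes it superharmonic
    have key := nonneg_of_superharmonic ha hb hab hS
      (u := fun z => M * (16 * ((z.1 : ℝ) - i) ^ 2 + (K + 4) * R * z.2 - K * (z.2 : ℝ) ^ 2)
        - R ^ 2 * u z) ?_ ?_ (i, j) ⟨hj, hjR, by simp; omega, by simp; omega⟩
    · simp only [sub_self] at key
      nlinarith [mul_nonneg hM (mul_nonneg hK0.le (sq_nonneg (j : ℝ)))]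
    · rintro ⟨k, l⟩ ⟨h1, h2, h3, h4⟩
      dsimp only at h1 h2 h3 h4
      have h := mul_le_mul_of_nonneg_left
        (hsub (k, l) ⟨by dsimp only; omega, h1⟩ (by dsimp only; omega)) (sq_nonneg (R : ℝ))
      simp only [nbrAvg] at h ⊢
      push_cast
      linear_combination h + M * (16 * (((k : ℝ) - i) ^ 2 + 1) + (K + 4) * R * l - K * l ^ 2) * hab
        - 2 * M * hK
    · rintro ⟨k, l⟩ ⟨h1, h2, h3, h4⟩ ⟨k', l'⟩ e1 e2 e3 e4 e5 e6 hw
      dsimp only at h1 h2 h3 h4 e1 e2 e3 e4 e5 e6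
      simp only [sub_nonneg]
      have hlR : (l' : ℝ) ≤ R := by exact_mod_cast (by omega : l' ≤ (R : ℤ))
      have hl0 : (0 : ℝ) ≤ l' := by exact_mod_cast (by omega : 0 ≤ l')
      have hpos : 0 ≤ (K + 4) * R * l' - K * (l' : ℝ) ^ 2 := by
        nlinarith [mul_nonneg (mul_nonneg hK0.le hl0) (sub_nonneg.2 hlR),
          mul_nonneg hl0 (by positivity : (0 : ℝ) ≤ R)]
      by_cases hq : ((k', l') : ℤ × ℤ) ∈ quadrant
      · have hu := hle _ hq (by dsimp only; omega)
        rw [mul_comm]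
        refine mul_le_mul hu ?_ (by positivity) hM
        by_cases hl : 4 * l' < R
        · have hk : (R : ℤ) ≤ 4 * (k' - i) ∨ (R : ℤ) ≤ 4 * (i - k') := by
            by_contra! hcon
            exact hw ⟨hq.2, hl, hcon.1, hcon.2⟩
          have : (R : ℝ) ^ 2 ≤ 16 * ((k' : ℝ) - i) ^ 2 := by
            rcases hk with hk | hk
            · have : (R : ℝ) ≤ 4 * (k' - i) := by exact_mod_cast hk
              nlinarith
            · have : (R : ℝ) ≤ 4 * (i - k') := by exact_mod_cast hk
              nlinarith
          linarith
        · have hl4 : (R : ℝ) ≤ 4 * l' := by exact_mod_cast not_lt.1 hl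
          nlinarith [sq_nonneg ((k' : ℝ) - i),
            mul_nonneg (mul_nonneg hK0.le hl0) (sub_nonneg.2 hlR)]
      · exact (mul_nonpos_of_nonneg_of_nonpos (by positivity) (hout _ hq)).trans
          (mul_nonneg hM (by nlinarith [sq_nonneg ((k' : ℝ) - i)]))
  · have hj4 : (R : ℝ) ≤ 4 * j := by exact_mod_cast not_lt.1 hjR
    have hu := hle (i, j) ⟨by dsimp only; omega, hj⟩ (by dsimp only; omega)
    rw [mul_comm]
    refine mul_le_mul hu ?_ (by positivity) hM
    nlinarith [mul_pos hK0 (by nlinarith : (0 : ℝ) < R * j)]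

/-- The estimate of `le_barrier_bottom` on the side `i = 0`. -/
lemma le_barrier_left (ha : 0 < a) (hb : 0 < b) (hab : 2 * a + 2 * b = 1) (hK : K * b = 8)
    (hR : 2 ≤ R) (hM : 0 ≤ M)
    (hsub : ∀ z ∈ quadrant, z.1 + z.2 < 2 * R → u z ≤ nbrAvg a b u z)
    (hout : ∀ z ∉ quadrant, u z ≤ 0) (hle : ∀ z ∈ quadrant, z.1 + z.2 ≤ 2 * R → u z ≤ M)
    {i j : ℤ} (hi : 1 ≤ i) (hij : i + j = R) (hj : (R : ℤ) ≤ 2 * j) :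
    R ^ 2 * u (i, j) ≤ M * ((K + 4) * R * i) := by
  have hK0 : 0 < K := by by_contra! h; nlinarith
  have hR' : (2 : ℝ) ≤ R := by exact_mod_cast hR
  by_cases hiR : 4 * i < R
  · set S : Set (ℤ × ℤ) := {z | 1 ≤ z.1 ∧ 4 * z.1 < R ∧ 4 * (z.2 - j) < R ∧ 4 * (j - z.2) < R}
    have hS : S.Finite := by
      refine (Set.finite_Icc ((1, j - R) : ℤ × ℤ) (R, j + R)).subset ?_
      rintro ⟨k, l⟩ ⟨h1, h2, h3, h4⟩
      simp only [Set.mem_Icc, Prod.mk_le_mk] at *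
      omega
    have key := nonneg_of_superharmonic ha hb hab hS
      (u := fun z => M * (16 * ((z.2 : ℝ) - j) ^ 2 + (K + 4) * R * z.1 - K * (z.1 : ℝ) ^ 2)
        - R ^ 2 * u z) ?_ ?_ (i, j) ⟨hi, hiR, by simp; omega, by simp; omega⟩
    · simp only [sub_self] at key
      nlinarith [mul_nonneg hM (mul_nonneg hK0.le (sq_nonneg (i : ℝ)))]
    · rintro ⟨k, l⟩ ⟨h1, h2, h3, h4⟩
      dsimp only at h1 h2 h3 h4
      have h := mul_le_mul_of_nonneg_left
        (hsub (k, l) ⟨h1, by dsimp only; omega⟩ (by dsimp only; omega)) (sq_nonneg (R : ℝ))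
      have hK16 : 32 * b * M ≤ K * M := by
        have h32 : 32 * b ≤ K := by nlinarith
        exact mul_le_mul_of_nonneg_right h32 hM
      simp only [nbrAvg] at h ⊢
      push_cast
      linear_combination h + M * (16 * ((l : ℝ) - j) ^ 2 + (K + 4) * R * k - K * (k ^ 2 + 1)) * hab
        + hK16
    · rintro ⟨k, l⟩ ⟨h1, h2, h3, h4⟩ ⟨k', l'⟩ e1 e2 e3 e4 e5 e6 hw
      dsimp only at h1 h2 h3 h4 e1 e2 e3 e4 e5 e6
      simp only [sub_nonneg]
      have hkR : (k' : ℝ) ≤ R := by exact_mod_cast (by omega : k' ≤ (R : ℤ))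
      have hk0 : (0 : ℝ) ≤ k' := by exact_mod_cast (by omega : 0 ≤ k')
      have hpos : 0 ≤ (K + 4) * R * k' - K * (k' : ℝ) ^ 2 := by
        nlinarith [mul_nonneg (mul_nonneg hK0.le hk0) (sub_nonneg.2 hkR),
          mul_nonneg hk0 (by positivity : (0 : ℝ) ≤ R)]
      by_cases hq : ((k', l') : ℤ × ℤ) ∈ quadrant
      · have hu := hle _ hq (by dsimp only; omega)
        rw [mul_comm]
        refine mul_le_mul hu ?_ (by positivity) hM
        by_cases hk : 4 * k' < R
        · have hl : (R : ℤ) ≤ 4 * (l' - j) ∨ (R : ℤ) ≤ 4 * (j - l') := by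
            by_contra! hcon
            exact hw ⟨hq.1, hk, hcon.1, hcon.2⟩
          have : (R : ℝ) ^ 2 ≤ 16 * ((l' : ℝ) - j) ^ 2 := by
            rcases hl with hl | hl
            · have : (R : ℝ) ≤ 4 * (l' - j) := by exact_mod_cast hl
              nlinarith
            · have : (R : ℝ) ≤ 4 * (j - l') := by exact_mod_cast hl
              nlinarith
          linarith
        · have hk4 : (R : ℝ) ≤ 4 * k' := by exact_mod_cast not_lt.1 hk
          nlinarith [sq_nonneg ((l' : ℝ) - j),
            mul_nonneg (mul_nonneg hK0.le hk0) (sub_nonneg.2 hkR)]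
      · exact (mul_nonpos_of_nonneg_of_nonpos (by positivity) (hout _ hq)).trans
          (mul_nonneg hM (by nlinarith [sq_nonneg ((l' : ℝ) - j)]))
  · have hi4 : (R : ℝ) ≤ 4 * i := by exact_mod_cast not_lt.1 hiR
    have hu := hle (i, j) ⟨hi, by dsimp only; omega⟩ (by dsimp only; omega)
    rw [mul_comm]
    refine mul_le_mul hu ?_ (by positivity) hM
    nlinarith [mul_pos hK0 (by nlinarith : (0 : ℝ) < R * i)]

end Barrier

section Profile
variable {a b c C : ℝ} {N : ℕ} {F : ℤ × ℤ → ℝ}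

/-- A subharmonic function in a triangle of size `2 R` which is at most `0` on the axes and at most
`M` on the hypotenuse is controlled in the triangle of size `R` by the profile. In probabilistic
terms: the walk reaches the hypotenuse before the axes with probability `O(F / R ^ (N + 2))`. -/
lemma IsProfile.le_of_subharmonic (hF : IsProfile a b N c C F) (ha : 0 < a) (hb : 0 < b)
    (hab : 2 * a + 2 * b = 1) : ∃ K : ℝ, 0 < K ∧ ∀ R : ℕ, 2 ≤ R → ∀ (u : ℤ × ℤ → ℝ) (M : ℝ),
      0 ≤ M → (∀ z ∈ quadrant, z.1 + z.2 < 2 * R → u z ≤ nbrAvg a b u z) →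
      (∀ z ∉ quadrant, u z ≤ 0) → (∀ z ∈ quadrant, z.1 + z.2 = 2 * R → u z ≤ M) →
      ∀ z ∈ quadrant, z.1 + z.2 ≤ R → R ^ (N + 2) * u z ≤ K * M * F z := by
  obtain ⟨K, hK⟩ : ∃ K : ℝ, K * b = 8 := ⟨8 / b, div_mul_cancel₀ _ hb.ne'⟩
  have hK0 : 0 < K := by by_contra! h; nlinarith
  have hc := hF.c_pos
  refine ⟨2 * (K + 4) / c, by positivity, fun R hR u M hM hsub hout harc => ?_⟩
  have hR' : (2 : ℝ) ≤ R := by exact_mod_cast hR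
  -- the maximum principle gives the bound `M` in the whole triangle
  have hle : ∀ z ∈ quadrant, z.1 + z.2 ≤ 2 * R → u z ≤ M := by
    intro z hz hzR
    rcases hzR.lt_or_eq with hlt | heq
    · have := nonneg_of_superharmonic ha hb hab (finite_triangle (2 * R)) (u := fun z => M - u z)
        ?_ ?_ z ⟨hz, hlt⟩
      · simpa using this
      · rintro w ⟨hw, hwR⟩
        have := hsub w hw hwR
        simp only [nbrAvg] at this ⊢
        linear_combination this + M * hab
      · rintro w ⟨hw, hwR⟩ w' e1 e2 e3 e4 e5 e6 hw'
        simp only [sub_nonneg]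
        by_cases hq : w' ∈ quadrant
        · exact harc w' hq (by by_contra; exact hw' ⟨hq, by omega⟩)
        · exact (hout _ hq).trans hM
    · exact harc z hz heq
  -- the barriers give the claim on the hypotenuse of the smaller triangle
  have hhyp : ∀ z ∈ quadrant, z.1 + z.2 = R → R ^ (N + 2) * u z ≤ 2 * (K + 4) / c * M * F z := by
    rintro ⟨i, j⟩ ⟨hi, hj⟩ hij
    dsimp only at hi hj hij
    have hi' : (1 : ℝ) ≤ i := by exact_mod_cast hi
    have hj' : (1 : ℝ) ≤ j := by exact_mod_cast hj
    have hij' : (i : ℝ) + j = R := by exact_mod_cast hij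
    have hbar : R ^ 2 * u (i, j) ≤ M * (2 * (K + 4) * (i * j)) := by
      rcases le_total j i with h | h
      · refine (le_barrier_bottom ha hb hab hK hR hM hsub hout hle hj hij (by omega)).trans ?_
        have h' : (R : ℝ) ≤ 2 * i := by exact_mod_cast (by omega : (R : ℤ) ≤ 2 * i)
        refine mul_le_mul_of_nonneg_left ?_ hM
        nlinarith [mul_le_mul_of_nonneg_left h' (by positivity : 0 ≤ (K + 4) * (j : ℝ))]
      · refine (le_barrier_left ha hb hab hK hR hM hsub hout hle hi hij (by omega)).trans ?_
        have h' : (R : ℝ) ≤ 2 * j := by exact_mod_cast (by omega : (R : ℤ) ≤ 2 * j)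
        refine mul_le_mul_of_nonneg_left ?_ hM
        nlinarith [mul_le_mul_of_nonneg_left h' (by positivity : 0 ≤ (K + 4) * (i : ℝ))]
    have hlow := hF.lower (i, j) ⟨hi, hj⟩
    dsimp only at hlow
    rw [hij'] at hlow
    have h1 := mul_le_mul_of_nonneg_left hbar (by positivity : (0 : ℝ) ≤ R ^ N)
    have h2 := mul_le_mul_of_nonneg_left hlow (by positivity : 0 ≤ 2 * (K + 4) / c * M)
    have h3 : 2 * (K + 4) / c * M * (c * (i * j * R ^ N))
        = R ^ N * (M * (2 * (K + 4) * (i * j))) := by field_simp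
    rw [pow_add]
    linarith
  intro z hz hzR
  rcases hzR.lt_or_eq with hlt | heq
  · have := nonneg_of_superharmonic ha hb hab (finite_triangle R)
      (u := fun z => 2 * (K + 4) / c * M * F z - R ^ (N + 2) * u z) ?_ ?_ z ⟨hz, hlt⟩
    · simpa using this
    · rintro w ⟨hw, hwR⟩
      have h1 := mul_le_mul_of_nonneg_left (hsub w hw (by omega))
        (by positivity : (0 : ℝ) ≤ R ^ (N + 2))
      have h2 := hF.harmonic w hw
      simp only [nbrAvg] at h1 h2 ⊢
      linear_combination h1 + 2 * (K + 4) / c * M * h2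
    · rintro w ⟨hw, hwR⟩ w' e1 e2 e3 e4 e5 e6 hw'
      simp only [sub_nonneg]
      by_cases hq : w' ∈ quadrant
      · exact hhyp w' hq (by by_contra; exact hw' ⟨hq, by omega⟩)
      · rw [hF.zero w' hq, mul_zero]
        exact mul_nonpos_of_nonneg_of_nonpos (by positivity) (hout _ hq)
  · exact hhyp z hz heq

/-- A harmonic function of the killed walk: harmonic in the quadrant and zero elsewhere. -/
structure IsKilledHarmonic (a b : ℝ) (u : ℤ × ℤ → ℝ) : Prop where
  zero : ∀ z ∉ quadrant, u z = 0
  harmonic : ∀ z ∈ quadrant, nbrAvg a b u z = u z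

/-- A positive harmonic function which increases in both coordinates dominates the profile. -/
lemma IsProfile.le_of_monotone (hF : IsProfile a b N c C F) (ha : 0 < a) (hb : 0 < b)
    (hab : 2 * a + 2 * b = 1) {h : ℤ × ℤ → ℝ} (hh : IsKilledHarmonic a b h) (hnn : ∀ z, 0 ≤ h z)
    (hone : 0 < h (1, 1)) (hmono : ∀ z ∈ quadrant, ∀ w, z ≤ w → h z ≤ h w) :
    ∃ κ : ℝ, 0 < κ ∧ ∀ z, F z ≤ κ * h z := by
  obtain ⟨K, hK, hmain⟩ := hF.le_of_subharmonic ha hb hab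
  have hc := hF.c_pos
  have hC := hF.C_pos
  have h11 : ((1, 1) : ℤ × ℤ) ∈ quadrant := ⟨le_rfl, le_rfl⟩
  have hF1 : 0 < F (1, 1) := lt_of_lt_of_le (by norm_num; positivity) (hF.lower _ h11)
  -- growth of `h` along the diagonal
  have hgrow : ∀ R : ℕ, 2 ≤ R →
      h (1, 1) / (K * F (1, 1)) * R ^ (N + 2) ≤ h (2 * R, 2 * R) := by
    intro R hR
    have := hmain R hR h (h (2 * R, 2 * R)) (hnn _) (fun z hz _ => (hh.harmonic z hz).ge)
      (fun z hz => (hh.zero z hz).le)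
      (fun z hz hzR => hmono z hz _ ⟨by have := hz.2; dsimp only; omega,
        by have := hz.1; dsimp only; omega⟩) (1, 1) h11 (by dsimp only; omega)
    rw [div_mul_eq_mul_div, div_le_iff₀ (by positivity)]
    linarith
  obtain ⟨L, hL⟩ := exists_nat_ge (2 * K * C * 2 ^ (N + 2))
  have hL0 : (0 : ℝ) < L := lt_of_lt_of_le (by positivity) hL
  have hL1 : 1 ≤ L := by exact_mod_cast hL0
  set κ : ℝ := C * (2 * L) ^ (N + 2) / (h (1, 1) / (K * F (1, 1))) with hκ
  have hκ0 : 0 < κ := by positivity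
  refine ⟨2 * κ, by positivity, fun z => ?_⟩
  by_cases hz : z ∈ quadrant
  swap
  · simp [hF.zero z hz, hh.zero z hz]
  obtain ⟨R, hR2, hzR⟩ : ∃ R : ℕ, 2 ≤ R ∧ z.1 + z.2 ≤ R :=
    ⟨(z.1 + z.2).toNat, by obtain ⟨h1, h2⟩ := hz; omega, by omega⟩
  have hR' : (2 : ℝ) ≤ R := by exact_mod_cast hR2
  -- on the part of the hypotenuse near the axes `F` is small, on the rest `h` is large
  have key := hmain (L * R) (by nlinarith) (fun z => F z - κ * h z)
    (C * (2 * R * (2 * L * R) ^ (N + 1))) (by positivity) ?_ ?_ ?_ z hz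
    (by push_cast; nlinarith [(by exact_mod_cast hL1 : (1 : ℤ) ≤ L)])
  · have hFz : 0 ≤ F z := le_trans (by
      have h1 : (1 : ℝ) ≤ z.1 := by exact_mod_cast hz.1
      have h2 : (1 : ℝ) ≤ z.2 := by exact_mod_cast hz.2
      positivity) (hF.lower z hz)
    have h1 : K * (C * (2 * R * (2 * L * R) ^ (N + 1))) * F z * 2
        ≤ ((L * R : ℕ) : ℝ) ^ (N + 2) * F z := by
      have e : K * (C * (2 * R * (2 * L * R) ^ (N + 1))) * F z * 2
          = (2 * K * C * 2 ^ (N + 2)) * (L ^ (N + 1) * R ^ (N + 2) * F z) := by ring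
      rw [e]
      refine (mul_le_mul_of_nonneg_right hL (by positivity)).trans_eq ?_
      push_cast
      ring
    have hpos : (0 : ℝ) < ((L * R : ℕ) : ℝ) ^ (N + 2) := by push_cast; positivity
    have h2 : ((L * R : ℕ) : ℝ) ^ (N + 2) * (F z - 2 * κ * h z) ≤ 0 := by
      linarith
    nlinarith [nonpos_of_mul_nonpos_right h2 hpos]
  · intro w hw _
    have h1 := hF.harmonic w hw
    have h2 := hh.harmonic w hw
    simp only [nbrAvg] at h1 h2 ⊢
    linear_combination κ * h2 - h1
  · intro w hw
    simp [hF.zero w hw, hh.zero w hw]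
  · rintro ⟨i, j⟩ hw hwR
    have hi' : (1 : ℝ) ≤ i := by exact_mod_cast hw.1
    have hj' : (1 : ℝ) ≤ j := by exact_mod_cast hw.2
    have hij : (i : ℝ) + j = 2 * L * R := by
      push_cast at hwR
      rw [mul_assoc]
      exact_mod_cast hwR
    have hhw := mul_nonneg hκ0.le (hnn (i, j))
    by_cases hi : i < 2 * R
    · have := hF.upper_left _ hw
      dsimp only at this
      rw [hij] at this
      have hi2 : (i : ℝ) ≤ 2 * R := by exact_mod_cast hi.le
      have h3 : C * (i * (2 * L * R) ^ (N + 1)) ≤ C * (2 * R * (2 * L * R) ^ (N + 1)) := by gcongr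
      linarith
    by_cases hj : j < 2 * R
    · have := hF.upper_right _ hw
      dsimp only at this
      rw [hij] at this
      have hj2 : (j : ℝ) ≤ 2 * R := by exact_mod_cast hj.le
      have h3 : C * (j * (2 * L * R) ^ (N + 1)) ≤ C * (2 * R * (2 * L * R) ^ (N + 1)) := by gcongr
      linarith
    · have h1 := hmono (2 * R, 2 * R) ⟨by dsimp only; omega, by dsimp only; omega⟩ (i, j)
        ⟨by dsimp only; omega, by dsimp only; omega⟩
      have h2 := mul_le_mul_of_nonneg_left ((hgrow R hR2).trans h1) hκ0.le
      have h3 := hF.upper_left _ hw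
      dsimp only at h3
      rw [hij] at h3
      have h4 : κ * (h (1, 1) / (K * F (1, 1)) * R ^ (N + 2)) = C * (2 * L * R) ^ (N + 2) := by
        rw [hκ, mul_pow _ (R : ℝ)]
        field_simp
      have h5 : C * (i * (2 * L * R) ^ (N + 1)) ≤ C * (2 * L * R) ^ (N + 2) := by
        rw [pow_succ' _ (N + 1)]
        gcongr
        linarith
      have h6 : 0 ≤ C * (2 * R * (2 * L * R) ^ (N + 1)) := by positivity
      linarith

end Profile

/-! ### The killed transition operator and translations of harmonic functions -/

open Filter Topology

open Classical in
/-- The transition operator of the killed walk, acting on functions on `ℤ × ℤ`. -/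
def killed (a b : ℝ) : (ℤ × ℤ → ℝ) →ₗ[ℝ] (ℤ × ℤ → ℝ) where
  toFun u z := if z ∈ quadrant then nbrAvg a b u z else 0
  map_add' u v := by
    ext z
    by_cases hz : z ∈ quadrant <;> simp [hz, nbrAvg]
    ring
  map_smul' r u := by
    ext z
    by_cases hz : z ∈ quadrant <;> simp [hz, nbrAvg]
    ring

section Killed
variable {a b : ℝ} {u v h : ℤ × ℤ → ℝ} {z : ℤ × ℤ}

lemma killed_of_mem (hz : z ∈ quadrant) : killed a b u z = nbrAvg a b u z := if_pos hz

lemma killed_of_notMem (hz : z ∉ quadrant) : killed a b u z = 0 := if_neg hz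

lemma killed_pow_succ (k : ℕ) : (killed a b ^ (k + 1)) u = killed a b ((killed a b ^ k) u) := by
  rw [pow_succ']; rfl

lemma killed_pow_succ' (k : ℕ) : (killed a b ^ (k + 1)) u = (killed a b ^ k) (killed a b u) := by
  rw [pow_succ]; rfl

lemma killed_mono (ha : 0 < a) (hb : 0 < b) (huv : u ≤ v) : killed a b u ≤ killed a b v := by
  intro z
  by_cases hz : z ∈ quadrant
  · rw [killed_of_mem hz, killed_of_mem hz, nbrAvg, nbrAvg]
    gcongr <;> exact huv _
  · rw [killed_of_notMem hz, killed_of_notMem hz]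

lemma killed_pow_mono (ha : 0 < a) (hb : 0 < b) (huv : u ≤ v) (k : ℕ) :
    (killed a b ^ k) u ≤ (killed a b ^ k) v := by
  induction k with
  | zero => simpa using huv
  | succ k ih => rw [killed_pow_succ, killed_pow_succ]; exact killed_mono ha hb ih

lemma killed_pow_nonneg (ha : 0 < a) (hb : 0 < b) (hu : 0 ≤ u) (k : ℕ) :
    0 ≤ (killed a b ^ k) u := by
  simpa using killed_pow_mono ha hb hu k

lemma killed_le (hu : IsPosSuper a b u) : killed a b u ≤ u := by
  intro z
  by_cases hz : z ∈ quadrant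
  · rw [killed_of_mem hz]; exact hu.2 z hz
  · rw [killed_of_notMem hz]; exact hu.1 z

lemma IsKilledHarmonic.killed_eq (hh : IsKilledHarmonic a b h) : killed a b h = h := by
  ext z
  by_cases hz : z ∈ quadrant
  · rw [killed_of_mem hz, hh.harmonic z hz]
  · rw [killed_of_notMem hz, hh.zero z hz]

lemma IsKilledHarmonic.killed_pow_eq (hh : IsKilledHarmonic a b h) (k : ℕ) :
    (killed a b ^ k) h = h := by
  induction k with
  | zero => simp
  | succ k ih => rw [killed_pow_succ, ih, hh.killed_eq]

lemma IsKilledHarmonic.of_killed_eq (hh : killed a b h = h) : IsKilledHarmonic a b h where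
  zero z hz := by rw [← hh, killed_of_notMem hz]
  harmonic z hz := by conv_rhs => rw [← hh, killed_of_mem hz]

lemma IsKilledHarmonic.isPosSuper (hh : IsKilledHarmonic a b h) (hnn : ∀ z, 0 ≤ h z) :
    IsPosSuper a b h := ⟨hnn, fun z hz => (hh.harmonic z hz).le⟩

/-- The greatest harmonic minorant of a positive superharmonic function is the limit of its
iterates under the killed transition operator. -/
lemma IsPosSuper.exists_tendsto (ha : 0 < a) (hb : 0 < b) (hu : IsPosSuper a b u) :
    ∃ g, IsKilledHarmonic a b g ∧ 0 ≤ g ∧ g ≤ u ∧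
      ∀ z, Tendsto (fun k => (killed a b ^ k) u z) atTop (𝓝 (g z)) := by
  have hanti : ∀ z, Antitone fun k => (killed a b ^ k) u z := fun z =>
    antitone_nat_of_succ_le fun k => by
      rw [killed_pow_succ']; exact killed_pow_mono ha hb (killed_le hu) k z
  have hnn : ∀ k z, 0 ≤ (killed a b ^ k) u z := fun k => killed_pow_nonneg ha hb hu.1 k
  have hlim : ∀ z, Tendsto (fun k => (killed a b ^ k) u z) atTop
      (𝓝 (⨅ k, (killed a b ^ k) u z)) := fun z =>
    tendsto_atTop_ciInf (hanti z) ⟨0, by rintro _ ⟨k, rfl⟩; exact hnn k z⟩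
  refine ⟨fun z => ⨅ k, (killed a b ^ k) u z, .of_killed_eq ?_, fun z => ?_, fun z => ?_, hlim⟩
  · ext z
    refine tendsto_nhds_unique ?_ ((tendsto_add_atTop_iff_nat 1).2 (hlim z))
    by_cases hz : z ∈ quadrant
    · simp only [killed_pow_succ, killed_of_mem hz, nbrAvg]
      exact ((((hlim _).const_mul a).add ((hlim _).const_mul a)).add ((hlim _).const_mul b)).add
        ((hlim _).const_mul b)
    · simp only [killed_pow_succ, killed_of_notMem hz]
      exact tendsto_const_nhds
  · exact ge_of_tendsto' (hlim z) fun k => hnn k z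
  · exact le_of_tendsto' (hlim z) fun k => by simpa using hanti z (Nat.zero_le k)

open Classical in
/-- The translate `u (· + (s, t))`, restricted to the quadrant and extended by zero. -/
def translate (s t : ℕ) (u : ℤ × ℤ → ℝ) (z : ℤ × ℤ) : ℝ :=
  if z ∈ quadrant then u (z.1 + s, z.2 + t) else 0

lemma translate_of_mem (s t : ℕ) (hz : z ∈ quadrant) :
    translate s t u z = u (z.1 + s, z.2 + t) := if_pos hz

lemma translate_of_notMem (s t : ℕ) (hz : z ∉ quadrant) : translate s t u z = 0 := if_neg hz

lemma translate_le (s t : ℕ) (hu : ∀ z, 0 ≤ u z) : translate s t u z ≤ u (z.1 + s, z.2 + t) := by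
  by_cases hz : z ∈ quadrant
  · rw [translate_of_mem s t hz]
  · rw [translate_of_notMem s t hz]; exact hu _

lemma IsPosSuper.translate (ha : 0 < a) (hb : 0 < b) (hu : IsPosSuper a b u) (s t : ℕ) :
    IsPosSuper a b (translate s t u) := by
  refine ⟨fun z => ?_, fun z hz => ?_⟩
  · by_cases hz : z ∈ quadrant
    · rw [translate_of_mem s t hz]; exact hu.1 _
    · rw [translate_of_notMem s t hz]
  · have h1 := hu.2 (z.1 + s, z.2 + t)
      (by obtain ⟨h1, h2⟩ := hz; constructor <;> dsimp only <;> omega)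
    rw [translate_of_mem s t hz]
    refine le_trans ?_ h1
    simp only [nbrAvg]
    have e : ∀ p q : ℤ, KilledWalk.translate s t u (p, q) ≤ u (p + s, q + t) := fun p q =>
      translate_le s t hu.1
    have e1 := e (z.1 + 1) z.2
    have e2 := e (z.1 - 1) z.2
    have e3 := e (z.1 + 1) (z.2 - 1)
    have e4 := e (z.1 - 1) (z.2 + 1)
    rw [add_right_comm z.1] at e1 e3
    rw [sub_add_eq_add_sub] at e2 e4
    rw [sub_add_eq_add_sub] at e3
    rw [add_right_comm z.2] at e4
    gcongr

lemma IsPosSuper.translate_le_mul (ha : 0 < a) (hb : 0 < b) (hu : IsPosSuper a b u) (s t : ℕ) :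
    KilledWalk.translate s t u ≤ (a ^ s * (a * b) ^ t)⁻¹ • u := by
  intro z
  simp only [Pi.smul_apply, smul_eq_mul]
  by_cases hz : z ∈ quadrant
  · rw [translate_of_mem s t hz, inv_mul_eq_div, le_div_iff₀' (by positivity)]
    exact hu.shift_le ha hb hz.1 hz.2 s t
  · rw [translate_of_notMem s t hz]
    have := hu.1 z
    positivity

/-- A harmonic function normalized at `(1, 1)` which dominates no positive harmonic functions
other than its multiples. -/
structure IsMinimal (a b : ℝ) (h : ℤ × ℤ → ℝ) : Prop where
  harmonic : IsKilledHarmonic a b h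
  nonneg : ∀ z, 0 ≤ h z
  one : h (1, 1) = 1
  eq_smul : ∀ g, IsKilledHarmonic a b g → 0 ≤ g → (∃ C : ℝ, g ≤ C • h) → ∀ z, g z = g (1, 1) * h z

/-- `h` is an eigenfunction, of eigenvalue `r`, of the operator sending a harmonic function to the
greatest harmonic minorant of its translate. -/
def IsTranslateEigen (a b : ℝ) (h : ℤ × ℤ → ℝ) (s t : ℕ) (r : ℝ) : Prop :=
  ∀ z, Tendsto (fun k => (killed a b ^ k) (translate s t h) z) atTop (𝓝 (r * h z))

/-- Minimal harmonic functions are eigenfunctions of the translations, as the translates of `h` are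
bounded by multiples of `h`. -/
lemma IsMinimal.exists_eigen (ha : 0 < a) (hb : 0 < b) (hh : IsMinimal a b h) (s t : ℕ) :
    ∃ r : ℝ, 0 < r ∧ IsTranslateEigen a b h s t r ∧ r • h ≤ translate s t h := by
  have hps := hh.harmonic.isPosSuper hh.nonneg
  obtain ⟨g, hg, hg0, hgle, hlim⟩ := (hps.translate ha hb s t).exists_tendsto ha hb
  have hgh := hh.eq_smul g hg hg0 ⟨_, hgle.trans (hps.translate_le_mul ha hb s t)⟩
  refine ⟨g (1, 1), ?_, fun z => by rw [← hgh z]; exact hlim z, fun z => by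
    simpa [← hgh z] using hgle z⟩
  have hlow : (a ^ s * (a * b) ^ t) • h ≤ translate s t h := by
    intro z
    by_cases hz : z ∈ quadrant
    · rw [translate_of_mem s t hz]
      exact hps.le_shift ha hb hz.1 hz.2 s t
    · simp [translate_of_notMem s t hz, hh.harmonic.zero z hz]
  have : a ^ s * (a * b) ^ t ≤ g (1, 1) := by
    refine ge_of_tendsto' (hlim (1, 1)) fun k => ?_
    have := killed_pow_mono ha hb hlow k (1, 1)
    rw [map_smul, hh.harmonic.killed_pow_eq] at this
    simpa [hh.one] using this
  exact lt_of_lt_of_le (by positivity) this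

/-- Translation eigenvalues are multiplicative: `h (· + s) - r h` is a potential, and so are its
translates, which are bounded by its multiples. -/
lemma IsMinimal.eigen_mul (ha : 0 < a) (hb : 0 < b) (hh : IsMinimal a b h) {s t s' t' : ℕ}
    {r r' : ℝ} (hr : IsTranslateEigen a b h s t r) (hle : r • h ≤ translate s t h)
    (hr' : IsTranslateEigen a b h s' t' r') :
    IsTranslateEigen a b h (s + s') (t + t') (r * r') := by
  have hps := hh.harmonic.isPosSuper hh.nonneg
  set H := translate s t h - r • h with hH
  have hHs : IsPosSuper a b H := by
    refine ⟨fun z => sub_nonneg.2 (hle z), fun z hz => ?_⟩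
    have h1 := (hps.translate ha hb s t).2 z hz
    have h2 := hh.harmonic.harmonic z hz
    simp only [hH, nbrAvg, Pi.sub_apply, Pi.smul_apply, smul_eq_mul] at h1 h2 ⊢
    linear_combination h1 - r * h2
  have hlimH : ∀ z, Tendsto (fun k => (killed a b ^ k) H z) atTop (𝓝 0) := by
    intro z
    have := (hr z).sub_const (r * h z)
    rw [sub_self] at this
    refine this.congr fun k => ?_
    rw [hH, map_sub, map_smul, hh.harmonic.killed_pow_eq]
    rfl
  have heq : translate (s + s') (t + t') h = translate s' t' H + r • translate s' t' h := by
    ext z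
    by_cases hz : z ∈ quadrant
    · have hz' : ((z.1 + s', z.2 + t') : ℤ × ℤ) ∈ quadrant := by
        obtain ⟨h1, h2⟩ := hz; constructor <;> dsimp only <;> omega
      simp only [Pi.add_apply, Pi.smul_apply, translate_of_mem _ _ hz, hH, Pi.sub_apply,
        translate_of_mem s t hz', sub_add_cancel]
      push_cast
      congr 2 <;> ring
    · simp [translate_of_notMem _ _ hz]
  intro z
  have hC := hHs.translate_le_mul ha hb s' t'
  have hzero : Tendsto (fun k => (killed a b ^ k) (translate s' t' H) z) atTop (𝓝 0) := by
    refine squeeze_zero (fun k => killed_pow_nonneg ha hb (hHs.translate ha hb s' t').1 k z)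
      (fun k => killed_pow_mono ha hb hC k z) ?_
    simp only [map_smul, Pi.smul_apply, smul_eq_mul]
    simpa using (hlimH z).const_mul (a ^ s' * (a * b) ^ t')⁻¹
  have := hzero.add ((hr' z).const_mul r)
  rw [zero_add, ← mul_assoc] at this
  refine this.congr fun k => ?_
  rw [heq, map_add, map_smul]
  rfl

/-- A minimal harmonic function increases in both coordinates. Its translation eigenvalues `r` and
`r'` satisfy `a (r + 1 / r) + b (r / r' + r' / r) = 1 = 2 a + 2 b`, hence are equal to `1`. -/
lemma IsMinimal.monotone (ha : 0 < a) (hb : 0 < b) (hab : 2 * a + 2 * b = 1)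
    (hh : IsMinimal a b h) : ∀ z ∈ quadrant, ∀ w, z ≤ w → h z ≤ h w := by
  obtain ⟨r, hr0, hr, hrle⟩ := hh.exists_eigen ha hb 1 0
  obtain ⟨r', hr0', hr', hrle'⟩ := hh.exists_eigen ha hb 0 1
  have h11 := hh.eigen_mul ha hb hr hrle hr'
  have h20 := hh.eigen_mul ha hb hr hrle hr
  have h02 := hh.eigen_mul ha hb hr' hrle' hr'
  have h21 := hh.eigen_mul ha hb hr hrle h11
  have heq : translate 1 1 h = a • translate 2 1 h + a • translate 0 1 h + b • translate 2 0 h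
      + b • translate 0 2 h := by
    ext z
    by_cases hz : z ∈ quadrant
    · have := hh.harmonic.harmonic (z.1 + 1, z.2 + 1)
        (by obtain ⟨h1, h2⟩ := hz; constructor <;> dsimp only <;> omega)
      simp only [nbrAvg, add_sub_cancel_right, add_assoc] at this
      simp only [Pi.add_apply, Pi.smul_apply, translate_of_mem _ _ hz, smul_eq_mul]
      norm_num at this ⊢
      linarith
    · simp [translate_of_notMem _ _ hz]
  have hlim := (((h21 (1, 1)).const_mul a).add ((hr' (1, 1)).const_mul a)).add
    ((h20 (1, 1)).const_mul b) |>.add ((h02 (1, 1)).const_mul b)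
  have hone : r * r' = a * (r * (r * r')) + a * r' + b * (r * r) + b * (r' * r') := by
    have h11' := h11 (1, 1)
    simp only [hh.one, mul_one] at hlim h11'
    refine tendsto_nhds_unique h11' (hlim.congr fun k => ?_)
    have e : translate (1 + 0) (0 + 1) h = _ := heq
    rw [e]
    simp only [map_add, map_smul]
    rfl
  have hsq : a * r' * (r - 1) ^ 2 + b * (r - r') ^ 2 = 0 := by
    linear_combination (r * r') * (-hab) - hone
  have h1 : 0 ≤ a * r' * (r - 1) ^ 2 := by positivity
  have h2 : 0 ≤ b * (r - r') ^ 2 := by positivity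
  have hr1 : r = 1 := by
    have : (r - 1) ^ 2 = 0 := by
      have h3 : a * r' * (r - 1) ^ 2 = 0 := by linarith
      exact (mul_eq_zero.1 h3).resolve_left (by positivity)
    linarith [pow_eq_zero_iff (two_ne_zero) |>.1 this]
  have hr1' : r' = 1 := by
    have : (r - r') ^ 2 = 0 := by
      have h3 : b * (r - r') ^ 2 = 0 := by linarith
      exact (mul_eq_zero.1 h3).resolve_left (by positivity)
    linarith [pow_eq_zero_iff (two_ne_zero) |>.1 this]
  subst hr1 hr1'
  rintro ⟨i, j⟩ ⟨hi, hj⟩ ⟨k, l⟩ ⟨hik, hjl⟩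
  dsimp only at hi hj hik hjl
  have step1 : ∀ p q : ℤ, 1 ≤ p → 1 ≤ q → h (p, q) ≤ h (p + 1, q) := by
    intro p q hp hq
    have := hrle (p, q)
    rw [translate_of_mem _ _ (⟨hp, hq⟩ : ((p, q) : ℤ × ℤ) ∈ quadrant)] at this
    simpa using this
  have step2 : ∀ p q : ℤ, 1 ≤ p → 1 ≤ q → h (p, q) ≤ h (p, q + 1) := by
    intro p q hp hq
    have := hrle' (p, q)
    rw [translate_of_mem _ _ (⟨hp, hq⟩ : ((p, q) : ℤ × ℤ) ∈ quadrant)] at this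
    simpa using this
  refine le_trans (b := h (k, j)) ?_ ?_
  · induction k, hik using Int.leInduction with
    | base => exact le_rfl
    | succ p hp ih => exact ih.trans (step1 p j (by omega) hj)
  · induction l, hjl using Int.leInduction with
    | base => exact le_rfl
    | succ q hq ih => exact ih.trans (step2 k q (by omega) (by omega))

end Killed

/-! ### Uniqueness of the positive harmonic function -/

section Unique
variable {a b c C : ℝ} {N : ℕ} {F : ℤ × ℤ → ℝ}

/-- The positive harmonic functions of the killed walk normalized at `(1, 1)`. -/
def normalizedHarmonic (a b : ℝ) : Set (ℤ × ℤ → ℝ) :=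
  {u | IsKilledHarmonic a b u ∧ (∀ z, 0 ≤ u z) ∧ u (1, 1) = 1}

lemma one_one_mem_quadrant : ((1, 1) : ℤ × ℤ) ∈ quadrant := ⟨le_rfl, le_rfl⟩

lemma IsKilledHarmonic.eq_zero {u : ℤ × ℤ → ℝ} (ha : 0 < a) (hb : 0 < b)
    (hu : IsKilledHarmonic a b u) (hnn : ∀ z, 0 ≤ u z) (h0 : u (1, 1) = 0) (z : ℤ × ℤ) :
    u z = 0 := by
  by_cases hz : z ∈ quadrant
  · obtain ⟨c, hc, hle⟩ := exists_harnack ha hb one_one_mem_quadrant hz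
    have := hle u (hu.isPosSuper hnn)
    rw [h0] at this
    exact le_antisymm (nonpos_of_mul_nonpos_right this hc) (hnn z)
  · exact hu.zero z hz

lemma IsKilledHarmonic.lin_comb {u v : ℤ × ℤ → ℝ} (hu : IsKilledHarmonic a b u)
    (hv : IsKilledHarmonic a b v) (r s : ℝ) : IsKilledHarmonic a b (r • u + s • v) :=
  .of_killed_eq (by rw [map_add, map_smul, map_smul, hu.killed_eq, hv.killed_eq])

lemma isCompact_normalizedHarmonic (ha : 0 < a) (hb : 0 < b) :
    IsCompact (normalizedHarmonic a b) := by
  have hB : ∀ z : ℤ × ℤ, ∃ B : ℝ, ∀ u ∈ normalizedHarmonic a b, u z ≤ B := by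
    intro z
    by_cases hz : z ∈ quadrant
    · obtain ⟨c, hc, hle⟩ := exists_harnack ha hb one_one_mem_quadrant hz
      refine ⟨1 / c, fun u hu => ?_⟩
      rw [le_div_iff₀' hc, ← hu.2.2]
      exact hle u (hu.1.isPosSuper hu.2.1)
    · exact ⟨0, fun u hu => (hu.1.zero z hz).le⟩
  choose B hB using hB
  refine (isCompact_univ_pi fun z => isCompact_Icc (a := (0 : ℝ)) (b := B z)).of_isClosed_subset ?_
    fun u hu z _ => ⟨hu.2.1 z, hB z u hu⟩
  have e : normalizedHarmonic a b = (⋂ z ∈ quadrantᶜ, {u | u z = 0}) ∩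
      (⋂ z ∈ quadrant, {u | nbrAvg a b u z = u z}) ∩ (⋂ z, {u | 0 ≤ u z}) ∩ {u | u (1, 1) = 1} := by
    ext u
    simp only [normalizedHarmonic, Set.mem_ofPred_eq, Set.mem_inter_iff, Set.mem_iInter,
      Set.mem_compl_iff]
    exact ⟨fun h => ⟨⟨⟨h.1.zero, h.1.harmonic⟩, h.2.1⟩, h.2.2⟩,
      fun h => ⟨⟨h.1.1.1, h.1.1.2⟩, h.1.2, h.2⟩⟩
  rw [e]
  refine IsClosed.inter (IsClosed.inter (IsClosed.inter ?_ ?_) ?_) ?_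
  · exact isClosed_biInter fun z _ => isClosed_eq (continuous_apply z) continuous_const
  · refine isClosed_biInter fun z _ => isClosed_eq ?_ (continuous_apply z)
    simp only [nbrAvg]
    fun_prop
  · exact isClosed_iInter fun z => isClosed_le continuous_const (continuous_apply z)
  · exact isClosed_eq (continuous_apply _) continuous_const

lemma convex_normalizedHarmonic : Convex ℝ (normalizedHarmonic a b) := by
  intro u hu v hv r s hr hs hrs
  refine ⟨hu.1.lin_comb hv.1 r s, fun z => ?_, ?_⟩
  · have h1 := hu.2.1 z
    have h2 := hv.2.1 z
    simp only [Pi.add_apply, Pi.smul_apply, smul_eq_mul]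
    positivity
  · simp [hu.2.2, hv.2.2, hrs]

lemma isMinimal_of_mem_extremePoints (ha : 0 < a) (hb : 0 < b) {h : ℤ × ℤ → ℝ}
    (hh : h ∈ (normalizedHarmonic a b).extremePoints ℝ) : IsMinimal a b h := by
  obtain ⟨⟨hharm, hnn, hone⟩, hext⟩ := hh
  refine ⟨hharm, hnn, hone, fun g hg hg0 ⟨C, hC⟩ z => ?_⟩
  rcases (hg0 (1, 1)).eq_or_lt with h0 | hpos
  · have := hg.eq_zero ha hb hg0 h0.symm
    rw [this z, this (1, 1), zero_mul]
  simp only [Pi.zero_apply] at hpos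
  have hgC : g (1, 1) ≤ C := by simpa [hone] using hC (1, 1)
  -- write `h` as a convex combination of `g` and `h - g / (2 C)`, both normalized
  have hC0 : 0 < C := hpos.trans_le hgC
  set t := g (1, 1) / (2 * C) with ht
  have ht0 : 0 < t := by positivity
  have ht1 : t < 1 := by rw [ht, div_lt_one (by positivity)]; linarith
  have htC : t * (2 * C) = g (1, 1) := div_mul_cancel₀ _ (by positivity)
  have m1 : (g (1, 1))⁻¹ • g + (0 : ℝ) • g ∈ normalizedHarmonic a b := by
    refine ⟨hg.lin_comb hg _ _, fun z => ?_, ?_⟩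
    · have := hg0 z
      simp only [Pi.zero_apply] at this
      simp only [Pi.add_apply, Pi.smul_apply, smul_eq_mul, zero_mul, add_zero]
      positivity
    · simp [hpos.ne']
  have m2 : (1 - t)⁻¹ • h + (-((1 - t)⁻¹ * (2 * C)⁻¹)) • g ∈ normalizedHarmonic a b := by
    refine ⟨hharm.lin_comb hg _ _, fun z => ?_, ?_⟩
    · have e1 : g z ≤ C * h z := hC z
      have e2 : (2 * C)⁻¹ * g z ≤ h z := by
        rw [inv_mul_eq_div, div_le_iff₀ (by positivity)]
        nlinarith [mul_nonneg hC0.le (hnn z)]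
      have e3 : 0 ≤ (1 - t)⁻¹ * (h z - (2 * C)⁻¹ * g z) :=
        mul_nonneg (inv_nonneg.2 (by linarith)) (by linarith)
      simp only [Pi.add_apply, Pi.smul_apply, smul_eq_mul]
      linarith
    · have h1t : (1 - t) ≠ 0 := by linarith
      simp only [Pi.add_apply, Pi.smul_apply, smul_eq_mul, hone]
      rw [← htC]
      field_simp
      ring
  have := hext m1 m2 ⟨t, 1 - t, ht0, by linarith, by ring, ?_⟩
  · have := congr_fun this z
    simp only [Pi.add_apply, Pi.smul_apply, smul_eq_mul, zero_mul, add_zero] at this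
    rw [← this]
    field_simp
  · have h1t : (1 - t) ≠ 0 := by linarith
    ext w
    simp only [Pi.add_apply, Pi.smul_apply, smul_eq_mul]
    rw [← htC]
    field_simp
    ring

/-- The killed walk has, up to constants, only one positive harmonic function. Extremal normalized
harmonic functions are minimal, hence monotone, hence dominate the profile, hence are multiples of
it; the Krein–Milman theorem passes from the extremal ones to all of them. -/
theorem IsProfile.eq_of_nonneg (hF : IsProfile a b N c C F) (ha : 0 < a) (hb : 0 < b)
    (hab : 2 * a + 2 * b = 1) {h : ℤ × ℤ → ℝ} (hh : IsKilledHarmonic a b h) (hnn : ∀ z, 0 ≤ h z)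
    (z : ℤ × ℤ) : h z = h (1, 1) / F (1, 1) * F z := by
  have hFharm : IsKilledHarmonic a b F := ⟨hF.zero, hF.harmonic⟩
  have hFnn : ∀ z, 0 ≤ F z := by
    intro z
    by_cases hz : z ∈ quadrant
    · have h1 : (1 : ℝ) ≤ z.1 := by exact_mod_cast hz.1
      have h2 : (1 : ℝ) ≤ z.2 := by exact_mod_cast hz.2
      have := hF.c_pos
      exact le_trans (by positivity) (hF.lower z hz)
    · exact (hF.zero z hz).ge
  have hF1 : 0 < F (1, 1) := lt_of_lt_of_le (by have := hF.c_pos; norm_num; positivity)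
    (hF.lower _ one_one_mem_quadrant)
  have hextr : (normalizedHarmonic a b).extremePoints ℝ ⊆ {(F (1, 1))⁻¹ • F} := by
    intro g hg
    have hmin := isMinimal_of_mem_extremePoints ha hb hg
    obtain ⟨κ, -, hle⟩ := hF.le_of_monotone ha hb hab hmin.harmonic hmin.nonneg
      (by rw [hmin.one]; exact one_pos) (hmin.monotone ha hb hab)
    have := hmin.eq_smul F hFharm hFnn ⟨κ, hle⟩
    ext w
    rw [Pi.smul_apply, this w, smul_eq_mul, inv_mul_cancel_left₀ hF1.ne']
  have hsub : normalizedHarmonic a b ⊆ {(F (1, 1))⁻¹ • F} := by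
    rw [← closure_convexHull_extremePoints (isCompact_normalizedHarmonic ha hb)
      convex_normalizedHarmonic]
    refine closure_minimal (convexHull_min hextr (convex_singleton _)) isClosed_singleton
  rcases (hnn (1, 1)).eq_or_lt with h0 | hpos
  · rw [hh.eq_zero ha hb hnn h0.symm z, ← h0, zero_div, zero_mul]
  · have hmem : (h (1, 1))⁻¹ • h + (0 : ℝ) • h ∈ normalizedHarmonic a b := by
      refine ⟨hh.lin_comb hh _ _, fun z => ?_, ?_⟩
      · have := hnn z
        simp only [Pi.add_apply, Pi.smul_apply, smul_eq_mul, zero_mul, add_zero]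
        positivity
      · simp [hpos.ne']
    have := congr_fun (hsub hmem) z
    simp only [Pi.add_apply, Pi.smul_apply, smul_eq_mul, zero_mul, add_zero] at this
    rw [inv_mul_eq_iff_eq_mul₀ hpos.ne'] at this
    rw [this]
    ring

end Unique

/-! ### Taylor coefficients of powers of the Cayley transform -/

/-- The coefficient of `u ^ k` in the expansion of `((1 + u) / (1 - u)) ^ m`, defined by the
recursion that multiplication by `1 - u` yields. -/
def cayleyCoeff : ℕ → ℕ → ℕ
  | 0, _ => 1
  | _ + 1, 0 => 0
  | k + 1, m + 1 => cayleyCoeff k (m + 1) + cayleyCoeff (k + 1) m + cayleyCoeff k m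

@[simp] lemma cayleyCoeff_zero_left (m : ℕ) : cayleyCoeff 0 m = 1 := by
  cases m <;> rw [cayleyCoeff]

@[simp] lemma cayleyCoeff_succ_zero (k : ℕ) : cayleyCoeff (k + 1) 0 = 0 := by rw [cayleyCoeff]

lemma cayleyCoeff_succ_succ (k m : ℕ) : cayleyCoeff (k + 1) (m + 1) =
    cayleyCoeff k (m + 1) + cayleyCoeff (k + 1) m + cayleyCoeff k m := by rw [cayleyCoeff]

@[simp] lemma cayleyCoeff_one_left (m : ℕ) : cayleyCoeff 1 m = 2 * m := by
  induction m with
  | zero => simp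
  | succ m ih =>
    have := cayleyCoeff_succ_succ 0 m
    simp only [zero_add, cayleyCoeff_zero_left] at this
    omega

lemma cayleyCoeff_pos (k : ℕ) {m : ℕ} (hm : 1 ≤ m) : 0 < cayleyCoeff k m := by
  obtain ⟨m, rfl⟩ := Nat.exists_eq_add_of_le' hm
  induction k with
  | zero => simp
  | succ k ih => rw [cayleyCoeff_succ_succ]; omega

/-- The recursion in the degree alone, which comes from the differential equation
`(1 - u ^ 2) G' = 2 m G` of `G = ((1 + u) / (1 - u)) ^ m`. -/
lemma cayleyCoeff_three_term (k m : ℕ) : (k + 2) * cayleyCoeff (k + 2) m =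
    2 * m * cayleyCoeff (k + 1) m + k * cayleyCoeff k m := by
  induction m generalizing k with
  | zero => cases k <;> simp
  | succ m ih =>
    induction k with
    | zero =>
      have h1 := cayleyCoeff_succ_succ 1 m
      have h2 := ih 0
      simp only [zero_add, cayleyCoeff_one_left, Nat.reduceAdd, zero_mul, add_zero] at *
      rw [h1]
      linear_combination h2
    | succ k ihk =>
      have r1 := cayleyCoeff_succ_succ k m
      have r2 := cayleyCoeff_succ_succ (k + 1) m
      have r3 := cayleyCoeff_succ_succ (k + 2) m
      have s1 := ih k
      have s2 := ih (k + 1)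
      zify at *
      linear_combination ihk + s1 + s2 + (k + 3) * r3 - 2 * (m + 1) * r2 - (k + 1) * r1 + r2 + r1

lemma cayleyCoeff_le (k m : ℕ) : cayleyCoeff k m ≤ (2 * m) ^ k := by
  induction k using Nat.twoStepInduction with
  | zero => simp
  | one => simp
  | more k h1 h2 =>
    have h := cayleyCoeff_three_term k m
    rcases Nat.eq_zero_or_pos m with rfl | hm
    · simp
    refine Nat.le_of_mul_le_mul_left (h.trans_le ?_) (by omega : 0 < k + 2)
    have h3 : cayleyCoeff k m ≤ (2 * m) ^ (k + 2) :=
      h1.trans (Nat.pow_le_pow_right (by omega) (by omega))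
    have h4 := Nat.mul_le_mul_left (2 * m) h2
    rw [← pow_succ'] at h4
    calc 2 * m * cayleyCoeff (k + 1) m + k * cayleyCoeff k m
        ≤ (2 * m) ^ (k + 2) + k * (2 * m) ^ (k + 2) := add_le_add h4 (Nat.mul_le_mul_left k h3)
      _ ≤ (k + 2) * (2 * m) ^ (k + 2) := by nlinarith [Nat.zero_le ((2 * m) ^ (k + 2))]

lemma cayleyCoeff_add_le (k i t : ℕ) : cayleyCoeff (k + 1) (i + t) ≤
    cayleyCoeff (k + 1) i + t * (2 * (2 * (i + t)) ^ k) := by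
  induction t with
  | zero => simp
  | succ t ih =>
    have h1 := cayleyCoeff_le k (i + t)
    have h2 := cayleyCoeff_le k (i + t + 1)
    have h3 : (2 * (i + t)) ^ k ≤ (2 * (i + t + 1)) ^ k := Nat.pow_le_pow_left (by omega) k
    rw [← add_assoc, cayleyCoeff_succ_succ]
    have h4 := Nat.mul_le_mul_left (2 * t) h3
    nlinarith

lemma cayleyCoeff_mono (k : ℕ) : Monotone (cayleyCoeff k) := by
  refine monotone_nat_of_le_succ fun m => ?_
  cases k with
  | zero => simp
  | succ k => rw [cayleyCoeff_succ_succ]; omega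

/-! ### Total positivity -/

/-- For fixed `m`, log-concavity in `k` yields the total positivity of the rows `m` and `m + 1` and
a mixed inequality, by simultaneous induction on `k`. -/
lemma cayleyCoeff_ratio_of_logConcave {m : ℕ}
    (hlc : ∀ k, cayleyCoeff (k + 2) m * cayleyCoeff k m ≤ cayleyCoeff (k + 1) m ^ 2) (k : ℕ) :
    cayleyCoeff (k + 1) m * cayleyCoeff k (m + 1) ≤ cayleyCoeff (k + 1) (m + 1) * cayleyCoeff k m ∧
    cayleyCoeff (k + 2) m * cayleyCoeff k (m + 1) ≤
      cayleyCoeff (k + 1) m * cayleyCoeff (k + 1) (m + 1) := by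
  have hmixed : ∀ k,
      cayleyCoeff (k + 1) m * cayleyCoeff k (m + 1) ≤ cayleyCoeff (k + 1) (m + 1) * cayleyCoeff k m →
      cayleyCoeff (k + 2) m * cayleyCoeff k (m + 1) ≤
        cayleyCoeff (k + 1) m * cayleyCoeff (k + 1) (m + 1) := by
    intro k hk
    rcases Nat.eq_zero_or_pos m with rfl | hm
    · simp
    · refine Nat.le_of_mul_le_mul_right ?_ (cayleyCoeff_pos k hm)
      have h1 := Nat.mul_le_mul_left (cayleyCoeff (k + 1) m) hk
      have h2 := Nat.mul_le_mul_right (cayleyCoeff k (m + 1)) (hlc k)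
      nlinarith
  refine ⟨?_, hmixed k ?_⟩ <;>
  · induction k with
    | zero => simp
    | succ k ih =>
      have h1 := hmixed k ih
      have h2 := hlc k
      have r1 := cayleyCoeff_succ_succ k m
      have r2 := cayleyCoeff_succ_succ (k + 1) m
      zify at *
      linear_combination h1 + h2 + cayleyCoeff (k + 2) m * r1 - cayleyCoeff (k + 1) m * r2

lemma cayleyCoeff_logConcave (m k : ℕ) :
    cayleyCoeff (k + 2) m * cayleyCoeff k m ≤ cayleyCoeff (k + 1) m ^ 2 := by
  induction m generalizing k with
  | zero => simp
  | succ m ih =>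
    obtain ⟨h1, h2⟩ := cayleyCoeff_ratio_of_logConcave ih k
    have r1 := cayleyCoeff_succ_succ k m
    have r2 := cayleyCoeff_succ_succ (k + 1) m
    zify at *
    linear_combination h1 + h2 - cayleyCoeff (k + 1) (m + 1) * r1 + cayleyCoeff k (m + 1) * r2

/-- Total positivity of order two of the coefficients of `((1 + u) / (1 - u)) ^ m`. -/
lemma cayleyCoeff_mul_le {k l i v : ℕ} (hlk : l ≤ k) (hiv : i ≤ v) :
    cayleyCoeff k i * cayleyCoeff l v ≤ cayleyCoeff k v * cayleyCoeff l i := by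
  rcases Nat.eq_zero_or_pos i with rfl | hi
  · cases k with
    | zero => obtain rfl : l = 0 := by omega
              simp
    | succ k => simp
  have hadj : ∀ m, 1 ≤ m → cayleyCoeff k m * cayleyCoeff l (m + 1) ≤
      cayleyCoeff k (m + 1) * cayleyCoeff l m := by
    intro m hm
    induction k, hlk using Nat.le_induction with
    | base => rw [mul_comm]
    | succ k _ ih =>
      have h1 := (cayleyCoeff_ratio_of_logConcave (cayleyCoeff_logConcave m) k).1
      refine Nat.le_of_mul_le_mul_right ?_ (cayleyCoeff_pos k hm)
      have h2 := Nat.mul_le_mul_left (cayleyCoeff (k + 1) m) ih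
      have h3 := Nat.mul_le_mul_right (cayleyCoeff l m) h1
      nlinarith
  induction v, hiv using Nat.le_induction with
  | base => exact le_rfl
  | succ v hv ih =>
    refine Nat.le_of_mul_le_mul_right ?_ (cayleyCoeff_pos l (hi.trans_le hv))
    have h1 := Nat.mul_le_mul_right (cayleyCoeff l (v + 1)) ih
    have h2 := Nat.mul_le_mul_right (cayleyCoeff l i) (hadj v (hi.trans_le hv))
    nlinarith

/-- A quantitative form of `cayleyCoeff_mul_le` for `l = 1`. -/
lemma exists_le_cayleyCoeff_sub (k : ℕ) : ∃ c : ℝ, 0 < c ∧ ∀ i v : ℕ, i ≤ v →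
    c * (i * v * v ^ k * (v - i)) ≤ i * cayleyCoeff (k + 2) v - v * cayleyCoeff (k + 2) i := by
  induction k with
  | zero =>
    refine ⟨2, two_pos, fun i v _ => ?_⟩
    have h1 : (2 : ℝ) * cayleyCoeff 2 v = 2 * v * (2 * v) := by
      have := cayleyCoeff_three_term 0 v
      simp only [zero_add, cayleyCoeff_one_left, zero_mul, add_zero] at this
      exact_mod_cast this
    have h2 : (2 : ℝ) * cayleyCoeff 2 i = 2 * i * (2 * i) := by
      have := cayleyCoeff_three_term 0 i
      simp only [zero_add, cayleyCoeff_one_left, zero_mul, add_zero] at this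
      exact_mod_cast this
    linear_combination (v : ℝ) / 2 * h2 - (i : ℝ) / 2 * h1
  | succ k ih =>
    obtain ⟨c, hc, h⟩ := ih
    refine ⟨2 * c / (k + 3), by positivity, fun i v hiv => ?_⟩
    have hiv' : (i : ℝ) ≤ v := by exact_mod_cast hiv
    have h1 : ((k : ℝ) + 3) * cayleyCoeff (k + 3) v
        = 2 * v * cayleyCoeff (k + 2) v + (k + 1) * cayleyCoeff (k + 1) v := by
      exact_mod_cast cayleyCoeff_three_term (k + 1) v
    have h2 : ((k : ℝ) + 3) * cayleyCoeff (k + 3) i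
        = 2 * i * cayleyCoeff (k + 2) i + (k + 1) * cayleyCoeff (k + 1) i := by
      exact_mod_cast cayleyCoeff_three_term (k + 1) i
    have h3 : (v : ℝ) * cayleyCoeff (k + 1) i ≤ i * cayleyCoeff (k + 1) v := by
      have := cayleyCoeff_mul_le (k := k + 1) (l := 1) (by omega) hiv
      simp only [cayleyCoeff_one_left] at this
      have h' : (cayleyCoeff (k + 1) i : ℝ) * (2 * v) ≤ cayleyCoeff (k + 1) v * (2 * i) := by
        exact_mod_cast this
      linarith
    have h4 := h i v hiv
    have h5 : (v : ℝ) * (i * cayleyCoeff (k + 2) i) ≤ v * (v * cayleyCoeff (k + 2) i) := by gcongr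
    have h6 := mul_le_mul_of_nonneg_left h4 (by positivity : 0 ≤ 2 * (v : ℝ))
    have h7 := mul_le_mul_of_nonneg_left h3 (by positivity : 0 ≤ (k : ℝ) + 1)
    have key : 2 * c * (i * v * v ^ (k + 1) * (v - i)) ≤
        (k + 3) * (i * cayleyCoeff (k + 3) v - v * cayleyCoeff (k + 3) i) := by
      have e : 2 * c * (i * v * v ^ (k + 1) * ((v : ℝ) - i))
          = 2 * v * (c * (i * v * v ^ k * (v - i))) := by ring
      rw [e]
      refine h6.trans ?_
      linear_combination 2 * h5 + h7 - (i : ℝ) * h1 + (v : ℝ) * h2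
    rw [div_mul_eq_mul_div, div_le_iff₀' (by positivity)]
    exact key

/-! ### The function `f` as a trigonometric sum -/

open Finset in
/-- The sum over `k + l = n` of `d_k(v) d_l(i) sin ((k - l) π / n)`, where `d = cayleyCoeff`; at
`v = i + 2 j` it is a multiple of `f n (i, j)`. -/
def sineSum (n v i : ℕ) : ℝ :=
  ∑ p ∈ antidiagonal n, (cayleyCoeff p.1 v * cayleyCoeff p.2 i) *
    Real.sin (((p.1 : ℝ) - p.2) * (Real.pi / n))

/-- The antisymmetry of the sine turns `sineSum` into a sum of minors of the array `cayleyCoeff`. -/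
lemma two_mul_sineSum (n v i : ℕ) : 2 * sineSum n v i = ∑ p ∈ Finset.HasAntidiagonal.antidiagonal n,
    ((cayleyCoeff p.1 v * cayleyCoeff p.2 i - cayleyCoeff p.2 v * cayleyCoeff p.1 i : ℝ)) *
      Real.sin (((p.1 : ℝ) - p.2) * (Real.pi / n)) := by
  have h : sineSum n v i = ∑ p ∈ Finset.HasAntidiagonal.antidiagonal n,
      -((cayleyCoeff p.2 v * cayleyCoeff p.1 i : ℝ) *
        Real.sin (((p.1 : ℝ) - p.2) * (Real.pi / n))) := by
    rw [sineSum, ← Finset.Nat.sum_antidiagonal_swap]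
    refine Finset.sum_congr rfl fun p _ => ?_
    rw [Prod.fst_swap, Prod.snd_swap, ← neg_sub, neg_mul, Real.sin_neg, mul_neg]
  rw [two_mul]
  nth_rewrite 1 [sineSum]
  rw [h, ← Finset.sum_add_distrib]
  exact Finset.sum_congr rfl fun p _ => by ring

lemma sineSum_self (n v : ℕ) : sineSum n v v = 0 := by
  have := two_mul_sineSum n v v
  rw [Finset.sum_eq_zero fun p _ => by ring] at this
  linarith

lemma sin_sub_mul_pi_div_eq_zero {n : ℕ} (hn : n ≠ 0) {p : ℕ × ℕ}
    (hp : p ∈ Finset.HasAntidiagonal.antidiagonal n) (h : p.1 = 0 ∨ p.2 = 0) :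
    Real.sin (((p.1 : ℝ) - p.2) * (Real.pi / n)) = 0 := by
  have hn' : (n : ℝ) ≠ 0 := by exact_mod_cast hn
  rw [Finset.HasAntidiagonal.mem_antidiagonal] at hp
  rcases h with h | h
  · obtain rfl : p.2 = n := by omega
    rw [h, Nat.cast_zero, zero_sub, neg_mul, Real.sin_neg, mul_div_cancel₀ _ hn', Real.sin_pi,
      neg_zero]
  · obtain rfl : p.1 = n := by omega
    rw [h, Nat.cast_zero, sub_zero, mul_div_cancel₀ _ hn', Real.sin_pi]

lemma sineSum_zero_right {n : ℕ} (hn : n ≠ 0) (v : ℕ) : sineSum n v 0 = 0 := by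
  refine Finset.sum_eq_zero fun p hp => ?_
  rcases Nat.eq_zero_or_pos p.2 with h | h
  · rw [sin_sub_mul_pi_div_eq_zero hn hp (.inr h), mul_zero]
  · obtain ⟨k, hk⟩ := Nat.exists_eq_add_of_le' h
    rw [hk, cayleyCoeff_succ_zero, Nat.cast_zero, mul_zero, zero_mul]

/-- Total positivity makes all terms of `two_mul_sineSum` nonnegative; the one with
`p = (n - 1, 1)` yields the lower bound. -/
lemma exists_le_sineSum (N : ℕ) : ∃ c : ℝ, 0 < c ∧ ∀ i j : ℕ,
    c * (i * j * (i + j) ^ (N + 1)) ≤ sineSum (N + 3) (i + 2 * j) i := by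
  obtain ⟨c, hc, h⟩ := exists_le_cayleyCoeff_sub N
  have hn : (0 : ℝ) < (N + 3 : ℕ) := by positivity
  set s := Real.sin ((((N + 2 : ℕ) : ℝ) - (1 : ℕ)) * (Real.pi / (N + 3 : ℕ))) with hs
  have hs0 : 0 < s := by
    refine Real.sin_pos_of_pos_of_lt_pi ?_ ?_
    · have := Real.pi_pos
      push_cast
      have : (0 : ℝ) < N + 2 - 1 := by linarith [(Nat.cast_nonneg N : (0 : ℝ) ≤ N)]
      positivity
    · rw [mul_div_assoc', div_lt_iff₀ hn, mul_comm]
      refine mul_lt_mul_of_pos_left ?_ Real.pi_pos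
      push_cast
      linarith
  refine ⟨2 * c * s, by positivity, fun i j => ?_⟩
  have hle : i ≤ i + 2 * j := by omega
  have hterm : ∀ p ∈ Finset.HasAntidiagonal.antidiagonal (N + 3), 0 ≤ ((cayleyCoeff p.1 (i + 2 * j) *
      cayleyCoeff p.2 i - cayleyCoeff p.2 (i + 2 * j) * cayleyCoeff p.1 i : ℝ)) *
      Real.sin (((p.1 : ℝ) - p.2) * (Real.pi / (N + 3 : ℕ))) := by
    rintro ⟨k, l⟩ hp
    rw [Finset.HasAntidiagonal.mem_antidiagonal] at hp
    dsimp only at hp ⊢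
    have hkl : (k : ℝ) + l = (N + 3 : ℕ) := by exact_mod_cast hp
    have hpi := Real.pi_pos
    rcases le_total l k with hlk | hlk
    · have h1 : (cayleyCoeff k i : ℝ) * cayleyCoeff l (i + 2 * j)
          ≤ cayleyCoeff k (i + 2 * j) * cayleyCoeff l i := by
        exact_mod_cast cayleyCoeff_mul_le hlk hle
      have h2 : (l : ℝ) ≤ k := by exact_mod_cast hlk
      refine mul_nonneg (by linarith) (Real.sin_nonneg_of_nonneg_of_le_pi ?_ ?_)
      · exact mul_nonneg (by linarith) (by positivity)
      · rw [mul_div_assoc', div_le_iff₀ hn, mul_comm]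
        refine mul_le_mul_of_nonneg_left ?_ hpi.le
        linarith [(Nat.cast_nonneg l : (0 : ℝ) ≤ l)]
    · have h1 : (cayleyCoeff l i : ℝ) * cayleyCoeff k (i + 2 * j)
          ≤ cayleyCoeff l (i + 2 * j) * cayleyCoeff k i := by
        exact_mod_cast cayleyCoeff_mul_le hlk hle
      have h2 : (k : ℝ) ≤ l := by exact_mod_cast hlk
      refine mul_nonneg_of_nonpos_of_nonpos (by linarith)
        (Real.sin_nonpos_of_nonpos_of_neg_pi_le ?_ ?_)
      · exact mul_nonpos_of_nonpos_of_nonneg (by linarith) (by positivity)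
      · rw [mul_div_assoc', le_div_iff₀ hn]
        nlinarith [(Nat.cast_nonneg k : (0 : ℝ) ≤ k)]
  have hmem : ((N + 2, 1) : ℕ × ℕ) ∈ Finset.HasAntidiagonal.antidiagonal (N + 3) :=
    Finset.HasAntidiagonal.mem_antidiagonal.2 rfl
  have h1 := Finset.single_le_sum hterm hmem
  rw [← two_mul_sineSum] at h1
  simp only [cayleyCoeff_one_left, ← hs] at h1
  have h2 := h i (i + 2 * j) hle
  have h3 : (i : ℝ) * j * (i + j) ^ (N + 1) ≤ i * j * (i + 2 * j) ^ (N + 1) := by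
    gcongr
    linarith [(Nat.cast_nonneg j : (0 : ℝ) ≤ j)]
  have h4 := mul_le_mul_of_nonneg_right h2 hs0.le
  have h5 := mul_le_mul_of_nonneg_left h3 (by positivity : 0 ≤ 2 * c * s)
  push_cast at h1 h4
  refine h5.trans ?_
  have e : c * (i * (i + 2 * j) * (i + 2 * j) ^ N * ((i : ℝ) + 2 * j - i)) * s
      = 2 * c * s * (i * j * (i + 2 * j) ^ (N + 1)) := by ring
  linarith

lemma cayleyCoeff_le_mul_pow {l i : ℕ} {m : ℝ} (hl : 1 ≤ l) (hi : (i : ℝ) ≤ m) :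
    (cayleyCoeff l i : ℝ) ≤ 2 ^ l * (i * m ^ (l - 1)) := by
  obtain ⟨k, rfl⟩ := Nat.exists_eq_add_of_le' hl
  have h : (cayleyCoeff (k + 1) i : ℝ) ≤ (2 * i) ^ (k + 1) := by
    exact_mod_cast cayleyCoeff_le (k + 1) i
  refine h.trans ?_
  rw [mul_pow, pow_succ' (i : ℝ), Nat.add_sub_cancel]
  gcongr

lemma cayleyCoeff_le_pow {l i : ℕ} {m : ℝ} (hi : (i : ℝ) ≤ m) :
    (cayleyCoeff l i : ℝ) ≤ 2 ^ l * m ^ l := by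
  have h : (cayleyCoeff l i : ℝ) ≤ (2 * i) ^ l := by exact_mod_cast cayleyCoeff_le l i
  refine h.trans ?_
  rw [mul_pow]
  gcongr

/-- Upper bounds of `sineSum`: near the side `i = 0` all terms have a factor vanishing at `i = 0`,
and near the side `j = 0` one compares with `sineSum_self`. -/
lemma exists_sineSum_le (N : ℕ) : ∃ C : ℝ, 0 < C ∧ ∀ i j : ℕ,
    sineSum (N + 3) (i + 2 * j) i ≤ C * (i * (i + j) ^ (N + 2)) ∧
    sineSum (N + 3) (i + 2 * j) i ≤ C * (j * (i + j) ^ (N + 2)) := by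
  refine ⟨∑ p ∈ Finset.HasAntidiagonal.antidiagonal (N + 3), 4 * 2 ^ (N + 3) * 2 ^ (N + 3), ?_,
    fun i j => ?_⟩
  · exact Finset.sum_pos (fun p _ => by positivity) ⟨(N + 3, 0), by simp⟩
  set m : ℝ := 2 * (i + j) with hm
  have hm0 : 0 ≤ m := by positivity
  have hi : (i : ℝ) ≤ m := by
    rw [hm]
    linarith [(Nat.cast_nonneg j : (0 : ℝ) ≤ j), (Nat.cast_nonneg i : (0 : ℝ) ≤ i)]
  have hv : ((i + 2 * j : ℕ) : ℝ) ≤ m := by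
    rw [hm]; push_cast; linarith [(Nat.cast_nonneg i : (0 : ℝ) ≤ i)]
  have hmpow : ∀ x : ℝ, 4 * 2 ^ (N + 3) * 2 ^ (N + 3) * (x * ((i : ℝ) + j) ^ (N + 2))
      = 8 * 2 ^ (N + 3) * (x * m ^ (N + 2)) := by
    intro x; rw [hm, mul_pow]; ring
  constructor
  · rw [sineSum, Finset.sum_mul]
    refine Finset.sum_le_sum fun p hp => ?_
    have hkl := Finset.HasAntidiagonal.mem_antidiagonal.1 hp
    rw [hmpow]
    rcases Nat.eq_zero_or_pos p.2 with h | h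
    · rw [sin_sub_mul_pi_div_eq_zero (by omega) hp (.inr h), mul_zero]
      positivity
    · refine (mul_le_of_le_one_right (by positivity) (Real.sin_le_one _)).trans ?_
      refine (mul_le_mul (cayleyCoeff_le_pow hv) (cayleyCoeff_le_mul_pow h hi) (by positivity)
        (by positivity)).trans ?_
      have e1 : (2 : ℝ) ^ (N + 3) = 2 ^ p.1 * 2 ^ p.2 := by rw [← pow_add, hkl]
      have e2 : m ^ (N + 2) = m ^ p.1 * m ^ (p.2 - 1) := by rw [← pow_add]; congr 1; omega
      rw [e1, e2]
      have : 0 ≤ (2 : ℝ) ^ p.1 * 2 ^ p.2 * (i * (m ^ p.1 * m ^ (p.2 - 1))) := by positivity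
      linarith
  · rw [← sub_zero (sineSum (N + 3) (i + 2 * j) i), ← sineSum_self (N + 3) i, sineSum, sineSum,
      ← Finset.sum_sub_distrib, Finset.sum_mul]
    refine Finset.sum_le_sum fun p hp => ?_
    have hkl := Finset.HasAntidiagonal.mem_antidiagonal.1 hp
    rw [hmpow, ← sub_mul, ← sub_mul]
    have hmono : (cayleyCoeff p.1 i : ℝ) ≤ cayleyCoeff p.1 (i + 2 * j) := by
      exact_mod_cast cayleyCoeff_mono p.1 (by omega)
    refine (mul_le_of_le_one_right (mul_nonneg (by linarith) (by positivity))
      (Real.sin_le_one _)).trans ?_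
    rcases Nat.eq_zero_or_pos p.1 with h | h
    · rw [h]
      simp only [cayleyCoeff_zero_left, sub_self, zero_mul]
      positivity
    · obtain ⟨k, hk⟩ := Nat.exists_eq_add_of_le' h
      have h1 : (cayleyCoeff (k + 1) (i + 2 * j) : ℝ) ≤ cayleyCoeff (k + 1) i
          + ((2 * j : ℕ) : ℝ) * (2 * (2 * ((i + 2 * j : ℕ) : ℝ)) ^ k) := by
        exact_mod_cast cayleyCoeff_add_le k i (2 * j)
      have h2 : (2 * ((i + 2 * j : ℕ) : ℝ)) ^ k ≤ 2 ^ k * m ^ k := by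
        rw [mul_pow]; gcongr
      have h3 : (cayleyCoeff p.1 (i + 2 * j) : ℝ) - cayleyCoeff p.1 i ≤ 4 * j * (2 ^ k * m ^ k) := by
        rw [hk]
        have := mul_le_mul_of_nonneg_left h2 (by positivity : (0 : ℝ) ≤ 4 * j)
        push_cast at h1 this
        linarith
      refine (mul_le_mul h3 (cayleyCoeff_le_pow hi) (by positivity) (by positivity)).trans ?_
      have e1 : (2 : ℝ) ^ (N + 3) = 2 * (2 ^ k * 2 ^ p.2) := by
        rw [← pow_add, ← pow_succ']; congr 1; omega
      have e2 : m ^ (N + 2) = m ^ k * m ^ p.2 := by rw [← pow_add]; congr 1; omega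
      rw [e1, e2]
      have : 0 ≤ (2 : ℝ) ^ k * 2 ^ p.2 * (j * (m ^ k * m ^ p.2)) := by positivity
      linarith

/-! ### Taylor coefficients along the uniformization -/

/-- The coefficient of `z ^ k` in the Taylor expansion of `F` at `0`. -/
def taylorCoeff (k : ℕ) (F : ℂ → ℂ) : ℂ := iteratedDeriv k F 0 / (k.factorial : ℂ)

lemma taylorCoeff_congr {F G : ℂ → ℂ} (h : F =ᶠ[𝓝 0] G) (k : ℕ) :
    taylorCoeff k F = taylorCoeff k G := by
  rw [taylorCoeff, taylorCoeff, h.iteratedDeriv_eq]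

lemma taylorCoeff_add {F G : ℂ → ℂ} (hF : AnalyticAt ℂ F 0) (hG : AnalyticAt ℂ G 0) (k : ℕ) :
    taylorCoeff k (F + G) = taylorCoeff k F + taylorCoeff k G := by
  rw [taylorCoeff, iteratedDeriv_add hF.contDiffAt hG.contDiffAt, add_div]; rfl

lemma taylorCoeff_const_mul (r : ℂ) (F : ℂ → ℂ) (k : ℕ) :
    taylorCoeff k (fun z => r * F z) = r * taylorCoeff k F := by
  rw [taylorCoeff, iteratedDeriv_const_mul_field, mul_div_assoc]; rfl

lemma taylorCoeff_mul {F G : ℂ → ℂ} (hF : AnalyticAt ℂ F 0) (hG : AnalyticAt ℂ G 0) (k : ℕ) :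
    taylorCoeff k (F * G) =
      ∑ p ∈ Finset.HasAntidiagonal.antidiagonal k, taylorCoeff p.1 F * taylorCoeff p.2 G := by
  rw [taylorCoeff, iteratedDeriv_mul hF.contDiffAt hG.contDiffAt,
    Finset.Nat.sum_antidiagonal_eq_sum_range_succ (fun i j => taylorCoeff i F * taylorCoeff j G),
    Finset.sum_div]
  refine Finset.sum_congr rfl fun i hi => ?_
  rw [Nat.cast_choose ℂ (Nat.lt_succ_iff.1 (Finset.mem_range.1 hi)), taylorCoeff, taylorCoeff]
  have h1 : ((k.factorial : ℕ) : ℂ) ≠ 0 := by exact_mod_cast k.factorial_ne_zero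
  have h2 : ((i.factorial : ℕ) : ℂ) ≠ 0 := by exact_mod_cast i.factorial_ne_zero
  have h3 : (((k - i).factorial : ℕ) : ℂ) ≠ 0 := by exact_mod_cast (k - i).factorial_ne_zero
  field_simp

lemma taylorCoeff_linear_mul (c : ℂ) {F : ℂ → ℂ} (hF : AnalyticAt ℂ F 0) (k : ℕ) :
    taylorCoeff (k + 1) ((fun z => 1 + c * z) * F) = taylorCoeff (k + 1) F + c * taylorCoeff k F := by
  have hlin : AnalyticAt ℂ (fun z : ℂ => 1 + c * z) 0 := by fun_prop
  have hd : deriv (fun z : ℂ => 1 + c * z) = fun _ => c := by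
    ext z
    simp
  have h1 : ∀ l, taylorCoeff (l + 1) (fun z : ℂ => 1 + c * z) = if l = 0 then c else 0 := by
    intro l
    rw [taylorCoeff, iteratedDeriv_succ', hd, iteratedDeriv_const]
    split_ifs with h <;> simp [h]
  rw [taylorCoeff_mul hlin hF, Finset.Nat.sum_antidiagonal_succ, Finset.sum_eq_single (0, k)]
  · rw [h1, if_pos rfl]
    simp [taylorCoeff]
  · rintro ⟨i, j⟩ hp hne
    rw [Finset.HasAntidiagonal.mem_antidiagonal] at hp
    rw [h1, if_neg, zero_mul]
    rintro rfl
    exact hne (by simpa using hp)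
  · simp

/-- The Cayley transform `z ↦ (1 + c z) / (1 - c z)`. -/
def cayley (c z : ℂ) : ℂ := (1 + c * z) / (1 - c * z)

lemma eventually_one_sub_mul_ne_zero (c : ℂ) : ∀ᶠ z in 𝓝 (0 : ℂ), 1 - c * z ≠ 0 :=
  ContinuousAt.eventually_ne (by fun_prop) (by simp)

lemma analyticAt_cayley (c : ℂ) : AnalyticAt ℂ (cayley c) 0 :=
  AnalyticAt.div (by fun_prop) (by fun_prop) (by simp)

lemma taylorCoeff_cayley_pow (c : ℂ) (k m : ℕ) :
    taylorCoeff k (cayley c ^ m) = c ^ k * cayleyCoeff k m := by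
  induction m generalizing k with
  | zero =>
    have : (cayley c ^ 0 : ℂ → ℂ) = fun _ => 1 := by ext; simp
    rw [this, taylorCoeff, iteratedDeriv_const]
    cases k <;> simp
  | succ m ih =>
    induction k with
    | zero => simp [taylorCoeff, cayley]
    | succ k ihk =>
      have heq : ((fun z => 1 + (-c) * z) * cayley c ^ (m + 1) : ℂ → ℂ) =ᶠ[𝓝 0]
          (fun z => 1 + c * z) * cayley c ^ m := by
        filter_upwards [eventually_one_sub_mul_ne_zero c] with z hz
        simp only [Pi.mul_apply, Pi.pow_apply, pow_succ]
        rw [neg_mul, ← sub_eq_add_neg]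
        conv_lhs => rw [mul_left_comm]
        rw [mul_comm (1 + c * z)]
        congr 1
        rw [cayley, mul_div_cancel₀ _ hz]
      have h := taylorCoeff_congr heq (k + 1)
      rw [taylorCoeff_linear_mul _ ((analyticAt_cayley c).pow _),
        taylorCoeff_linear_mul _ ((analyticAt_cayley c).pow _), ih, ih, ihk] at h
      rw [cayleyCoeff_succ_succ]
      push_cast
      linear_combination h

lemma conj_z₀ (n : ℕ) : starRingEnd ℂ (z₀ n) = -Complex.exp (Complex.I * Real.pi / n) := by
  simp [z₀, ← Complex.exp_conj, neg_div]

lemma z₀_mul_conj (n : ℕ) : z₀ n * starRingEnd ℂ (z₀ n) = 1 := by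
  rw [conj_z₀, z₀, neg_mul_neg, ← Complex.exp_add, neg_add_cancel, Complex.exp_zero]

lemma z₀_add_conj (n : ℕ) : z₀ n + starRingEnd ℂ (z₀ n) = -2 * Real.cos (Real.pi / n) := by
  rw [conj_z₀, z₀, Complex.ofReal_cos, Complex.cos]
  push_cast
  have e : (Real.pi / n : ℂ) * Complex.I = Complex.I * Real.pi / n := by ring
  rw [neg_mul, e]
  ring_nf

lemma conj_pow_mul_pow (n k l : ℕ) : starRingEnd ℂ (z₀ n) ^ k * z₀ n ^ l =
    (-1) ^ (k + l) * Complex.exp ((((k : ℝ) - l) * (Real.pi / n) : ℝ) * Complex.I) := by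
  rw [conj_z₀, z₀, neg_pow, neg_pow (Complex.exp _), ← Complex.exp_nat_mul, ← Complex.exp_nat_mul,
    mul_mul_mul_comm, ← pow_add, ← Complex.exp_add]
  push_cast
  ring_nf

lemma add_div_sub_eq_neg_cayley {c d : ℂ} (hcd : c * d = 1) (z : ℂ) :
    (z + c) / (z - c) = -cayley d z := by
  have hc : c ≠ 0 := left_ne_zero_of_mul_eq_one hcd
  have h1 : z + c = c * (1 + d * z) := by linear_combination (-z) * hcd
  have h2 : z - c = -(c * (1 - d * z)) := by linear_combination (-z) * hcd
  rw [h1, h2, div_neg, mul_div_mul_left _ _ hc, cayley]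

/-- The functions `x(z) ^ i y(z) ^ j` are products of powers of Cayley transforms. -/
lemma kappa_eq_taylorCoeff (n p i j : ℕ) : kappa n p ((i : ℤ), (j : ℤ)) =
    taylorCoeff p (cayley (starRingEnd ℂ (z₀ n)) ^ (i + 2 * j) * cayley (z₀ n) ^ i) := by
  have : (fun z : ℂ => xFun n z ^ ((i : ℤ), (j : ℤ)).1 * yFun n z ^ ((i : ℤ), (j : ℤ)).2)
      = cayley (starRingEnd ℂ (z₀ n)) ^ (i + 2 * j) * cayley (z₀ n) ^ i := by
    ext z
    have h := z₀_mul_conj n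
    simp only [zpow_natCast, xFun, yFun, Pi.mul_apply, Pi.pow_apply]
    rw [mul_div_mul_comm, ← div_pow, add_div_sub_eq_neg_cayley h,
      add_div_sub_eq_neg_cayley ((mul_comm _ _).trans h), neg_mul_neg, neg_sq]
    ring
  rw [kappa, this, taylorCoeff]

lemma f_eq_im (n : ℕ) (w : ℤ × ℤ) : f n w = (-1) ^ n * (2 * n) * (kappa n n w).im := by
  have h1 : ((-1 : ℂ) ^ n) * (-1) ^ n = 1 := by rw [← mul_pow]; simp
  have h2 : (n : ℂ) * (kappa n n w - starRingEnd ℂ (kappa n n w)) / ((-1) ^ n * Complex.I)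
      = (((-1) ^ n * (2 * n) * (kappa n n w).im : ℝ) : ℂ) := by
    have h0 : (-1 : ℂ) ^ n ≠ 0 := left_ne_zero_of_mul_eq_one h1
    rw [Complex.sub_conj, div_eq_iff (mul_ne_zero h0 Complex.I_ne_zero)]
    push_cast
    linear_combination -(2 * n * (kappa n n w).im * Complex.I : ℂ) * h1
  rw [f, h2, Complex.ofReal_re]

lemma f_eq_sineSum (n i j : ℕ) :
    f n ((i : ℤ), (j : ℤ)) = 2 * n * sineSum n (i + 2 * j) i := by
  have him : (kappa n n ((i : ℤ), (j : ℤ))).im = (-1) ^ n * sineSum n (i + 2 * j) i := by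
    rw [kappa_eq_taylorCoeff, taylorCoeff_mul ((analyticAt_cayley _).pow _)
      ((analyticAt_cayley _).pow _), Complex.im_sum, sineSum, Finset.mul_sum]
    refine Finset.sum_congr rfl fun p hp => ?_
    rw [Finset.HasAntidiagonal.mem_antidiagonal] at hp
    rw [taylorCoeff_cayley_pow, taylorCoeff_cayley_pow, mul_mul_mul_comm, conj_pow_mul_pow, hp]
    have e : ((-1 : ℂ) ^ n * Complex.exp ((((p.1 : ℝ) - p.2) * (Real.pi / n) : ℝ) * Complex.I)
        * (cayleyCoeff p.1 (i + 2 * j) * cayleyCoeff p.2 i))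
        = (((-1) ^ n * (cayleyCoeff p.1 (i + 2 * j) * cayleyCoeff p.2 i) : ℝ) : ℂ) *
          Complex.exp ((((p.1 : ℝ) - p.2) * (Real.pi / n) : ℝ) * Complex.I) := by
      push_cast; ring
    rw [e, Complex.im_ofReal_mul, Complex.exp_ofReal_mul_I_im]
    ring
  have h1 : ((-1 : ℝ) ^ n) * (-1) ^ n = 1 := by rw [← mul_pow]; simp
  rw [f_eq_im, him]
  linear_combination (2 * n * sineSum n (i + 2 * j) i) * h1

/-- The curve parametrized by `x(z)` and `y(z)` is the zero set of the kernel of the walk. -/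
lemma cayley_kernel (n : ℕ) : ∀ᶠ z in 𝓝 (0 : ℂ),
    (Real.sin (Real.pi / n) ^ 2 / 2 : ℂ) *
      ((cayley (starRingEnd ℂ (z₀ n)) z * cayley (z₀ n) z) ^ 2 + 1) +
    (Real.cos (Real.pi / n) ^ 2 / 2 : ℂ) *
      (cayley (starRingEnd ℂ (z₀ n)) z ^ 2 + cayley (z₀ n) z ^ 2) =
    cayley (starRingEnd ℂ (z₀ n)) z * cayley (z₀ n) z := by
  have hprod := z₀_mul_conj n
  have hsum := z₀_add_conj n
  have hsin : (Real.sin (Real.pi / n) : ℂ) ^ 2 = 1 - (Real.cos (Real.pi / n) : ℂ) ^ 2 := by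
    have := Real.sin_sq_add_cos_sq (Real.pi / n)
    rw [eq_sub_iff_add_eq]
    exact_mod_cast this
  rw [hsin]
  generalize (Real.cos (Real.pi / n) : ℂ) = t at *
  filter_upwards [eventually_one_sub_mul_ne_zero (z₀ n),
    eventually_one_sub_mul_ne_zero (starRingEnd ℂ (z₀ n))] with z hz hz'
  generalize z₀ n = c at *
  generalize starRingEnd ℂ c = d at *
  have hN : (1 + d * z) * (1 + c * z) = 1 - 2 * t * z + z ^ 2 := by
    linear_combination z * hsum + z ^ 2 * hprod
  have hD : (1 - d * z) * (1 - c * z) = 1 + 2 * t * z + z ^ 2 := by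
    linear_combination (-z) * hsum + z ^ 2 * hprod
  have hA : ((1 + d * z) * (1 - c * z)) ^ 2 + ((1 + c * z) * (1 - d * z)) ^ 2
      = 2 * (1 - z ^ 2) ^ 2 + 2 * (4 * t ^ 2 - 4) * z ^ 2 := by
    have e1 : (1 + d * z) * (1 - c * z) = 1 - z ^ 2 + (d - c) * z := by
      linear_combination (-z ^ 2) * hprod
    have e2 : (1 + c * z) * (1 - d * z) = 1 - z ^ 2 - (d - c) * z := by
      linear_combination (-z ^ 2) * hprod
    have e3 : (d - c) ^ 2 = 4 * t ^ 2 - 4 := by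
      linear_combination (c + d - 2 * t) * hsum - 4 * hprod
    rw [e1, e2]
    linear_combination 2 * z ^ 2 * e3
  have hcl : (1 - t ^ 2) / 2 * (((1 + d * z) * (1 + c * z)) ^ 2 + ((1 - d * z) * (1 - c * z)) ^ 2)
      + t ^ 2 / 2 * (((1 + d * z) * (1 - c * z)) ^ 2 + ((1 + c * z) * (1 - d * z)) ^ 2)
      = ((1 + d * z) * (1 + c * z)) * ((1 - d * z) * (1 - c * z)) := by
    rw [hA, hN, hD]
    ring
  have hd : cayley d z * (1 - d * z) = 1 + d * z := div_mul_cancel₀ _ hz'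
  have hc : cayley c z * (1 - c * z) = 1 + c * z := div_mul_cancel₀ _ hz
  rw [← hd, ← hc] at hcl
  refine mul_left_cancel₀ (pow_ne_zero 2 (mul_ne_zero hz' hz)) ?_
  linear_combination hcl

lemma f_harmonic (n : ℕ) {z : ℤ × ℤ} (hz : z ∈ quadrant) :
    nbrAvg (Real.sin (Real.pi / n) ^ 2 / 2) (Real.cos (Real.pi / n) ^ 2 / 2) (f n) z = f n z := by
  obtain ⟨i, j⟩ := z
  obtain ⟨hi, hj⟩ := hz
  dsimp only at hi hj
  obtain ⟨i, rfl⟩ := Int.le.dest hi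
  obtain ⟨j, rfl⟩ := Int.le.dest hj
  set G := cayley (starRingEnd ℂ (z₀ n)) with hG
  set H := cayley (z₀ n) with hH
  have hGa : AnalyticAt ℂ G 0 := analyticAt_cayley _
  have hHa : AnalyticAt ℂ H 0 := analyticAt_cayley _
  set T : ℕ → ℕ → ℂ := fun k l => taylorCoeff n (G ^ k * H ^ l) with hT
  set a := Real.sin (Real.pi / n) ^ 2 / 2 with ha
  set b := Real.cos (Real.pi / n) ^ 2 / 2 with hb
  set v := i + 2 * j + 2 with hv
  have hmain : (a : ℂ) * T (v + 2) (i + 2) + (a : ℂ) * T v i + (b : ℂ) * T v (i + 2)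
      + (b : ℂ) * T (v + 2) i = T (v + 1) (i + 1) := by
    simp only [hT]
    rw [← taylorCoeff_const_mul, ← taylorCoeff_const_mul, ← taylorCoeff_const_mul,
      ← taylorCoeff_const_mul, ← taylorCoeff_add, ← taylorCoeff_add, ← taylorCoeff_add]
    · refine taylorCoeff_congr ?_ n
      filter_upwards [cayley_kernel n] with z hz
      simp only [Pi.add_apply, Pi.mul_apply, Pi.pow_apply]
      have ha' : (a : ℂ) = Real.sin (Real.pi / n) ^ 2 / 2 := by rw [ha]; push_cast; rfl
      have hb' : (b : ℂ) = Real.cos (Real.pi / n) ^ 2 / 2 := by rw [hb]; push_cast; rfl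
      rw [← ha', ← hb', ← hG, ← hH] at hz
      linear_combination (G z ^ v * H z ^ i) * hz
    all_goals
      have e : ∀ k l : ℕ, AnalyticAt ℂ (G ^ k * H ^ l) 0 := fun k l => (hGa.pow k).mul (hHa.pow l)
      have e' : ∀ (r : ℂ) (k l : ℕ), AnalyticAt ℂ (fun z => r * (G ^ k * H ^ l) z) 0 :=
        fun r k l => analyticAt_const.mul (e k l)
      first
      | exact e' _ _ _
      | exact (e' _ _ _).add (e' _ _ _)
      | exact ((e' _ _ _).add (e' _ _ _)).add (e' _ _ _)
  have hk : ∀ (p q : ℕ) (k l : ℤ), k = p → l = q → kappa n n (k, l) = T (p + 2 * q) p := by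
    rintro p q _ _ rfl rfl
    exact kappa_eq_taylorCoeff n n p q
  have him := congr_arg Complex.im hmain
  simp only [Complex.add_im, Complex.im_ofReal_mul] at him
  simp only [nbrAvg, f_eq_im]
  rw [hk (i + 2) (j + 1) (1 + i + 1) (1 + j) (by push_cast; ring) (by push_cast; ring),
    hk i (j + 1) (1 + i - 1) (1 + j) (by ring) (by push_cast; ring),
    hk (i + 2) j (1 + i + 1) (1 + j - 1) (by push_cast; ring) (by ring),
    hk i (j + 2) (1 + i - 1) (1 + j + 1) (by ring) (by push_cast; ring),
    hk (i + 1) (j + 1) (1 + i) (1 + j) (by push_cast; ring) (by push_cast; ring),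
    show i + 2 + 2 * (j + 1) = v + 2 by omega, show i + 2 * (j + 1) = v by omega,
    show i + 2 + 2 * j = v by omega, show i + 2 * (j + 2) = v + 2 by omega,
    show i + 1 + 2 * (j + 1) = v + 1 by omega]
  linear_combination ((-1) ^ n * (2 * n)) * him

lemma f_eq_zero {n : ℕ} (hn : n ≠ 0) {z : ℤ × ℤ} (h1 : 0 ≤ z.1) (h2 : 0 ≤ z.2)
    (hz : z ∉ quadrant) : f n z = 0 := by
  obtain ⟨i, j⟩ := z
  dsimp only at h1 h2
  lift i to ℕ using h1
  lift j to ℕ using h2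
  rw [f_eq_sineSum]
  have : i = 0 ∨ j = 0 := by
    by_contra! h
    exact hz ⟨by dsimp only; omega, by dsimp only; omega⟩
  rcases this with rfl | rfl
  · rw [sineSum_zero_right hn, mul_zero]
  · rw [mul_zero, add_zero, sineSum_self, mul_zero]

lemma extendZero_of_mem {h : quadrant → ℝ} {z : ℤ × ℤ} (hz : z ∈ quadrant) :
    extendZero h z = h ⟨z, hz⟩ := dif_pos hz

lemma extendZero_of_notMem {h : quadrant → ℝ} {z : ℤ × ℤ} (hz : z ∉ quadrant) :
    extendZero h z = 0 := dif_neg hz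

lemma extendZero_f {n : ℕ} (hn : n ≠ 0) {z : ℤ × ℤ} (h1 : 0 ≤ z.1) (h2 : 0 ≤ z.2) :
    extendZero (fun x => f n x) z = f n z := by
  by_cases hz : z ∈ quadrant
  · rw [extendZero_of_mem hz]
  · rw [extendZero_of_notMem hz, f_eq_zero hn h1 h2 hz]

lemma exists_isProfile {n : ℕ} (hn : 3 ≤ n) : ∃ (N : ℕ) (c C : ℝ),
    IsProfile (Real.sin (Real.pi / n) ^ 2 / 2) (Real.cos (Real.pi / n) ^ 2 / 2) N c C
      (extendZero fun x => f n x) := by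
  obtain ⟨N, rfl⟩ := Nat.exists_eq_add_of_le' hn
  obtain ⟨c, hc, hlow⟩ := exists_le_sineSum N
  obtain ⟨C, hC, hup⟩ := exists_sineSum_le N
  have hn0 : (0 : ℝ) < 2 * (N + 3 : ℕ) := by positivity
  have key : ∀ z ∈ quadrant, ∃ i j : ℕ, z = ((i : ℤ), (j : ℤ)) ∧
      extendZero (fun x => f (N + 3) x) z = 2 * (N + 3 : ℕ) * sineSum (N + 3) (i + 2 * j) i := by
    rintro ⟨i, j⟩ hz
    have hi : 0 ≤ i := by have := hz.1; dsimp only at this; omega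
    have hj : 0 ≤ j := by have := hz.2; dsimp only at this; omega
    rw [extendZero_of_mem hz]
    lift i to ℕ using hi
    lift j to ℕ using hj
    exact ⟨i, j, rfl, f_eq_sineSum _ _ _⟩
  refine ⟨N + 1, 2 * (N + 3 : ℕ) * c, 2 * (N + 3 : ℕ) * C, ?_⟩
  refine ⟨fun z hz => extendZero_of_notMem hz, fun z hz => ?_, by positivity, by positivity,
    fun z hz => ?_, fun z hz => ?_, fun z hz => ?_⟩
  · obtain ⟨h1, h2⟩ := id hz
    rw [extendZero_of_mem hz]
    refine Eq.trans ?_ (f_harmonic (N + 3) hz)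
    simp only [nbrAvg]
    rw [extendZero_f, extendZero_f, extendZero_f, extendZero_f] <;> (try dsimp only) <;> omega
  · obtain ⟨i, j, rfl, e⟩ := key z hz
    rw [e, mul_assoc]
    exact mul_le_mul_of_nonneg_left (hlow i j) hn0.le
  · obtain ⟨i, j, rfl, e⟩ := key z hz
    rw [e]
    exact (mul_le_mul_of_nonneg_left (hup i j).1 hn0.le).trans_eq (mul_assoc _ _ _).symm
  · obtain ⟨i, j, rfl, e⟩ := key z hz
    rw [e]
    exact (mul_le_mul_of_nonneg_left (hup i j).2 hn0.le).trans_eq (mul_assoc _ _ _).symm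

/-! ### The Green functions -/

open Classical in
/-- The indicator function of the point `w` if `w` is in the quadrant, and zero otherwise. -/
def pointMass (w z : ℤ × ℤ) : ℝ := if z = w ∧ z ∈ quadrant then 1 else 0

section PointMass
variable {a b : ℝ}

lemma pointMass_nonneg (w : ℤ × ℤ) : 0 ≤ pointMass w := fun z => by
  rw [pointMass]; split_ifs <;> simp

lemma pointMass_self {w : ℤ × ℤ} (hw : w ∈ quadrant) : pointMass w w = 1 := if_pos ⟨rfl, hw⟩

lemma pointMass_of_ne {w z : ℤ × ℤ} (h : z ≠ w) : pointMass w z = 0 := if_neg fun h' => h h'.1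

lemma pointMass_of_notMem {w z : ℤ × ℤ} (h : z ∉ quadrant) : pointMass w z = 0 :=
  if_neg fun h' => h h'.2

lemma pointMass_comm (w z : ℤ × ℤ) : pointMass w z = pointMass z w := by
  by_cases h : z = w
  · rw [h]
  · rw [pointMass_of_ne h, pointMass_of_ne (Ne.symm h)]

lemma pointMass_add {w z : ℤ × ℤ} (hw : w ∈ quadrant) (hz : z ∈ quadrant) (s t : ℤ) :
    pointMass w (z.1 + s, z.2 + t) = pointMass (w.1 - s, w.2 - t) z := by
  by_cases h : ((z.1 + s, z.2 + t) : ℤ × ℤ) = w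
  · have h' : z = (w.1 - s, w.2 - t) := by rw [← h]; ext <;> simp
    rw [h, pointMass_self hw, ← h', pointMass_self hz]
  · have h' : z ≠ (w.1 - s, w.2 - t) := fun h' => h (by rw [h']; ext <;> simp)
    rw [pointMass_of_ne h, pointMass_of_ne h']

lemma killed_pow_of_notMem (k : ℕ) {u : ℤ × ℤ → ℝ} (hu : ∀ z ∉ quadrant, u z = 0) {z : ℤ × ℤ}
    (hz : z ∉ quadrant) : (killed a b ^ k) u z = 0 := by
  cases k with
  | zero => exact hu z hz
  | succ k => rw [killed_pow_succ, killed_of_notMem hz]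

/-- The transition probabilities of the killed walk are symmetric. -/
lemma killed_pow_pointMass_comm (k : ℕ) (w z : ℤ × ℤ) :
    (killed a b ^ k) (pointMass w) z = (killed a b ^ k) (pointMass z) w := by
  induction k generalizing w with
  | zero => exact pointMass_comm w z
  | succ k ih =>
    by_cases hw : w ∈ quadrant
    · have hK : killed a b (pointMass w) = a • pointMass (w.1 + 1, w.2) + a • pointMass (w.1 - 1, w.2)
          + b • pointMass (w.1 + 1, w.2 - 1) + b • pointMass (w.1 - 1, w.2 + 1) := by
        ext z
        by_cases hz : z ∈ quadrant
        · have e1 := pointMass_add hw hz 1 0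
          have e2 := pointMass_add hw hz (-1) 0
          have e3 := pointMass_add hw hz 1 (-1)
          have e4 := pointMass_add hw hz (-1) 1
          simp only [add_zero, sub_zero, ← sub_eq_add_neg, sub_neg_eq_add] at e1 e2 e3 e4
          rw [killed_of_mem hz, nbrAvg, e1, e2, e3, e4]
          simp only [Pi.add_apply, Pi.smul_apply, smul_eq_mul]
          ring
        · simp [killed_of_notMem hz, pointMass_of_notMem hz]
      rw [killed_pow_succ', killed_pow_succ, killed_of_mem hw, hK]
      simp only [map_add, map_smul, Pi.add_apply, Pi.smul_apply, smul_eq_mul, ih, nbrAvg]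
    · have h0 : pointMass w = 0 := by
        ext z
        rw [pointMass_comm, pointMass_of_notMem hw]; rfl
      rw [h0, map_zero, killed_pow_of_notMem _ (fun z hz => pointMass_of_notMem hz) hw]
      rfl

/-- If `u + K V ≤ V` with `V ≥ 0`, where `K` is the killed transition operator, then `V` bounds the
potential of `u`. -/
lemma sum_killed_pow_le (ha : 0 < a) (hb : 0 < b) {u V : ℤ × ℤ → ℝ} (hV : 0 ≤ V)
    (huV : u + killed a b V ≤ V) (m : ℕ) : ∑ k ∈ Finset.range m, (killed a b ^ k) u ≤ V := by
  induction m with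
  | zero => simpa using hV
  | succ m ih =>
    rw [Finset.sum_range_succ']
    simp only [killed_pow_succ]
    rw [← map_sum, pow_zero, add_comm]
    refine le_trans (add_le_add le_rfl (killed_mono ha hb ih)) huV

open Classical in
/-- The potential of a point mass is bounded: the first coordinate performs a simple random walk
killed at `0`, whose Green function at `m` is `2 min (·, m)`. -/
lemma sum_killed_pow_pointMass_le (ha : 0 < a) (hb : 0 < b) (hab : 2 * a + 2 * b = 1) (w z : ℤ × ℤ)
    (hw : w ∈ quadrant) (m : ℕ) :
    ∑ k ∈ Finset.range m, (killed a b ^ k) (pointMass w) z ≤ 2 * w.1 := by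
  set V : ℤ × ℤ → ℝ := fun z => if z ∈ quadrant then 2 * min (z.1 : ℝ) w.1 else 0 with hVdef
  have hw1 : (1 : ℝ) ≤ w.1 := by exact_mod_cast hw.1
  have hV0 : 0 ≤ V := by
    intro z
    simp only [hVdef, Pi.zero_apply]
    split_ifs with h
    · have : (1 : ℝ) ≤ z.1 := by exact_mod_cast h.1
      have := le_min this hw1
      linarith
    · exact le_rfl
  have hVle : ∀ z : ℤ × ℤ, 0 ≤ z.1 → V z ≤ 2 * min (z.1 : ℝ) w.1 := by
    intro z hz
    simp only [hVdef]
    split_ifs with h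
    · exact le_rfl
    · have : (0 : ℝ) ≤ z.1 := by exact_mod_cast hz
      have := le_min this (by linarith : (0 : ℝ) ≤ w.1)
      linarith
  have hsup : pointMass w + killed a b V ≤ V := by
    intro z
    by_cases hz : z ∈ quadrant
    · have hz1 := hz.1
      have e1 := mul_le_mul_of_nonneg_left (hVle (z.1 + 1, z.2) (by dsimp only; omega)) ha.le
      have e2 := mul_le_mul_of_nonneg_left (hVle (z.1 - 1, z.2) (by dsimp only; omega)) ha.le
      have e3 := mul_le_mul_of_nonneg_left (hVle (z.1 + 1, z.2 - 1) (by dsimp only; omega)) hb.le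
      have e4 := mul_le_mul_of_nonneg_left (hVle (z.1 - 1, z.2 + 1) (by dsimp only; omega)) hb.le
      have hVz : V z = 2 * min (z.1 : ℝ) w.1 := if_pos hz
      have hpm : pointMass w z ≤ if z.1 = w.1 then 1 else 0 := by
        by_cases h : z = w
        · rw [h, pointMass_self hw, if_pos rfl]
        · rw [pointMass_of_ne h]; split_ifs <;> simp
      rw [Pi.add_apply, killed_of_mem hz, hVz, nbrAvg]
      push_cast at e1 e2 e3 e4
      have hsum : pointMass w z + (min ((z.1 : ℝ) + 1) w.1 + min ((z.1 : ℝ) - 1) w.1)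
          ≤ 2 * min (z.1 : ℝ) w.1 := by
        rcases lt_trichotomy z.1 w.1 with h | h | h
        · have h' : (z.1 : ℝ) + 1 ≤ w.1 := by exact_mod_cast h
          rw [if_neg h.ne] at hpm
          rw [min_eq_left h', min_eq_left (by linarith), min_eq_left (by linarith)]
          linarith
        · rw [if_pos h] at hpm
          rw [h, min_eq_right (by linarith), min_eq_left (by linarith), min_self]
          linarith
        · have h' : (w.1 : ℝ) + 1 ≤ z.1 := by exact_mod_cast h
          rw [if_neg h.ne'] at hpm
          rw [min_eq_right (by linarith), min_eq_right (by linarith), min_eq_right (by linarith)]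
          linarith
      have hab' : (a + b) = 1 / 2 := by linarith
      have := congr_arg (· * (2 * (min ((z.1 : ℝ) + 1) w.1 + min ((z.1 : ℝ) - 1) w.1))) hab'
      linarith
    · rw [Pi.add_apply, killed_of_notMem hz, pointMass_of_notMem hz, add_zero]
      exact hV0 z
  have h1 := sum_killed_pow_le ha hb hV0 hsup m z
  rw [Finset.sum_apply] at h1
  refine h1.trans ?_
  simp only [hVdef]
  split_ifs
  · linarith [min_le_right (z.1 : ℝ) w.1]
  · linarith

lemma summable_killed_pow_pointMass (ha : 0 < a) (hb : 0 < b) (hab : 2 * a + 2 * b = 1)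
    (w z : ℤ × ℤ) : Summable fun k => (killed a b ^ k) (pointMass w) z := by
  by_cases hw : w ∈ quadrant
  · exact summable_of_sum_range_le (fun k => killed_pow_nonneg ha hb (pointMass_nonneg w) k z)
      (sum_killed_pow_pointMass_le ha hb hab w z hw)
  · refine summable_zero.congr fun k => ?_
    rw [killed_pow_pointMass_comm, killed_pow_of_notMem _ (fun z hz => pointMass_of_notMem hz) hw]

/-- The Green function as a function of the starting point `z`, with target `w`. -/
def greenSum (a b : ℝ) (w z : ℤ × ℤ) : ℝ := ∑' k, (killed a b ^ k) (pointMass w) z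

lemma greenSum_nonneg (ha : 0 < a) (hb : 0 < b) (w z : ℤ × ℤ) : 0 ≤ greenSum a b w z :=
  tsum_nonneg fun k => killed_pow_nonneg ha hb (pointMass_nonneg w) k z

lemma greenSum_of_notMem (w : ℤ × ℤ) {z : ℤ × ℤ} (hz : z ∉ quadrant) : greenSum a b w z = 0 := by
  rw [greenSum, tsum_congr fun k =>
    killed_pow_of_notMem k (fun z hz => pointMass_of_notMem hz) hz, tsum_zero]

lemma greenSum_eq (ha : 0 < a) (hb : 0 < b) (hab : 2 * a + 2 * b = 1) (w : ℤ × ℤ) {z : ℤ × ℤ}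
    (hz : z ∈ quadrant) :
    greenSum a b w z = pointMass w z + nbrAvg a b (greenSum a b w) z := by
  have hs := summable_killed_pow_pointMass ha hb hab w
  rw [greenSum, (hs z).tsum_eq_zero_add, pow_zero]
  congr 1
  simp only [killed_pow_succ, killed_of_mem hz, nbrAvg, greenSum]
  rw [((((hs _).mul_left a).add ((hs _).mul_left a)).add ((hs _).mul_left b)).tsum_add
    ((hs _).mul_left b), (((hs _).mul_left a).add ((hs _).mul_left a)).tsum_add
    ((hs _).mul_left b), ((hs _).mul_left a).tsum_add ((hs _).mul_left a), tsum_mul_left,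
    tsum_mul_left, tsum_mul_left, tsum_mul_left]

lemma isPosSuper_greenSum (ha : 0 < a) (hb : 0 < b) (hab : 2 * a + 2 * b = 1) (w : ℤ × ℤ) :
    IsPosSuper a b (greenSum a b w) :=
  ⟨greenSum_nonneg ha hb w, fun z hz => by
    have := pointMass_nonneg w z
    rw [greenSum_eq ha hb hab w hz]
    simp only [Pi.zero_apply] at this
    linarith⟩

lemma greenSum_pos (ha : 0 < a) (hb : 0 < b) (hab : 2 * a + 2 * b = 1) {w z : ℤ × ℤ}
    (hw : w ∈ quadrant) (hz : z ∈ quadrant) : 0 < greenSum a b w z := by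
  have hsup := isPosSuper_greenSum ha hb hab w
  obtain ⟨c, hc, hle⟩ := exists_harnack ha hb hz hw
  refine lt_of_lt_of_le (mul_pos hc ?_) (hle _ hsup)
  rw [greenSum_eq ha hb hab w hw, pointMass_self hw]
  have : 0 ≤ nbrAvg a b (greenSum a b w) w := by
    have h := hsup.1
    rw [nbrAvg]
    have h1 := h (w.1 + 1, w.2)
    have h2 := h (w.1 - 1, w.2)
    have h3 := h (w.1 + 1, w.2 - 1)
    have h4 := h (w.1 - 1, w.2 + 1)
    positivity
  linarith

end PointMass

lemma sum_steps {M : Type*} [AddCommMonoid M] (g : ℤ × ℤ → M) :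
    ∑ s ∈ steps, g s = g (1, 0) + g (-1, 0) + g (1, -1) + g (-1, 1) := by
  rw [steps, Finset.sum_insert (by decide), Finset.sum_insert (by decide),
    Finset.sum_insert (by decide), Finset.sum_singleton]
  simp only [add_assoc]

section StepProb
variable (n : ℕ)

lemma stepProb_right : stepProb n (1, 0) = Real.sin (Real.pi / n) ^ 2 / 2 := by simp [stepProb]

lemma stepProb_left : stepProb n (-1, 0) = Real.sin (Real.pi / n) ^ 2 / 2 := by simp [stepProb]

lemma stepProb_down : stepProb n (1, -1) = Real.cos (Real.pi / n) ^ 2 / 2 := by simp [stepProb]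

lemma stepProb_up : stepProb n (-1, 1) = Real.cos (Real.pi / n) ^ 2 / 2 := by simp [stepProb]

lemma sum_stepProb_mul (u : ℤ × ℤ → ℝ) (z : ℤ × ℤ) : ∑ s ∈ steps, stepProb n s * u (z + s) =
    nbrAvg (Real.sin (Real.pi / n) ^ 2 / 2) (Real.cos (Real.pi / n) ^ 2 / 2) u z := by
  rw [sum_steps, stepProb_right, stepProb_left, stepProb_down, stepProb_up, nbrAvg]
  simp only [Prod.add_def, add_zero, ← sub_eq_add_neg]

end StepProb

lemma sin_pos_cos_pos {n : ℕ} (hn : 3 ≤ n) : 0 < Real.sin (Real.pi / n) ^ 2 / 2 ∧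
    0 < Real.cos (Real.pi / n) ^ 2 / 2 := by
  have hn' : (3 : ℝ) ≤ n := by exact_mod_cast hn
  have hpi := Real.pi_pos
  have h0 : 0 < Real.pi / n := by positivity
  have h1 : Real.pi / n < Real.pi / 2 := div_lt_div_of_pos_left hpi two_pos (by linarith)
  have h2 := Real.sin_pos_of_pos_of_lt_pi h0 (by linarith)
  have h3 := Real.cos_pos_of_mem_Ioo ⟨by linarith, h1⟩
  constructor <;> positivity

lemma two_mul_sin_add_two_mul_cos (n : ℕ) : 2 * (Real.sin (Real.pi / n) ^ 2 / 2) +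
    2 * (Real.cos (Real.pi / n) ^ 2 / 2) = 1 := by
  linarith [Real.sin_sq_add_cos_sq (Real.pi / n)]

/-! ### The law of the walk -/

lemma walk_congr (x : ℤ × ℤ) {ω ω' : ℕ → ℤ × ℤ} {k : ℕ} (h : ∀ i < k, ω i = ω' i) :
    walk x ω k = walk x ω' k := by
  induction k with
  | zero => rfl
  | succ k ih => rw [walk, walk, ih fun i hi => h i (by omega), h k (by omega)]

/-- The path `ω` up to time `k`, continued by zero. -/
def extendPath (k : ℕ) (ω : Finset.range k → ℤ × ℤ) (i : ℕ) : ℤ × ℤ :=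
  if h : i ∈ Finset.range k then ω ⟨i, h⟩ else 0

lemma walk_eq_extendPath (x : ℤ × ℤ) (k : ℕ) (ω : ℕ → ℤ × ℤ) :
    walk x ω k = walk x (extendPath k fun i => ω i) k :=
  walk_congr x fun i hi => by rw [extendPath, dif_pos (Finset.mem_range.2 hi)]

lemma measurable_walk (x : ℤ × ℤ) (k : ℕ) : Measurable fun ω => walk x ω k := by
  have h : (fun ω => walk x ω k) = (fun ω' => walk x (extendPath k ω') k) ∘
      fun (ω : ℕ → ℤ × ℤ) (i : Finset.range k) => ω i := by
    ext1 ω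
    exact walk_eq_extendPath x k ω
  rw [h]
  exact Measurable.of_discrete.comp (by fun_prop)

instance jumpsLaw_isProbabilityMeasure (n : ℕ) : IsProbabilityMeasure (jumpsLaw n) := by
  rw [jumpsLaw]; infer_instance

lemma indepFun_walk_jump (n : ℕ) (x : ℤ × ℤ) (k : ℕ) :
    IndepFun (fun ω => walk x ω k) (fun ω => ω k) (jumpsLaw n) := by
  have hind : iIndepFun (fun (i : ℕ) (ω : ℕ → ℤ × ℤ) => ω i) (jumpsLaw n) :=
    iIndepFun_infinitePi (P := fun _ => stepLaw n) (X := fun _ s => s) fun _ => measurable_id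
  have h := hind.indepFun_finset (Finset.range k) {k} (by simp) (fun i => measurable_pi_apply i)
  have h' := h.comp (φ := fun ω' => walk x (extendPath k ω') k)
    (ψ := fun ω' => ω' ⟨k, Finset.mem_singleton_self k⟩) Measurable.of_discrete
    Measurable.of_discrete
  have e : (fun ω => walk x ω k) = (fun ω' => walk x (extendPath k ω') k) ∘
      fun (ω : ℕ → ℤ × ℤ) (i : Finset.range k) => ω i := by
    ext1 ω
    exact walk_eq_extendPath x k ω
  rw [e]
  exact h'

/-- One-step forward equation for the law of the walk inside the quadrant. -/
lemma jumpsLaw_walk_succ (n : ℕ) (x : ℤ × ℤ) (k : ℕ) {y : ℤ × ℤ} (hy : y ∈ quadrant) :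
    jumpsLaw n {ω | walk x ω (k + 1) = y} = ∑ s ∈ steps, ENNReal.ofReal (stepProb n s) *
      jumpsLaw n {ω | walk x ω k ∈ quadrant ∧ walk x ω k + s = y} := by
  set A : Set ((ℤ × ℤ) × (ℤ × ℤ)) := {p | p.1 ∈ quadrant ∧ p.1 + p.2 = y} with hA
  have hmA : MeasurableSet A := MeasurableSet.of_discrete
  have hset : {ω | walk x ω (k + 1) = y} = (fun ω => (walk x ω k, ω k)) ⁻¹' A := by
    ext ω
    simp only [hA, Set.mem_preimage, Set.mem_ofPred_eq, walk]
    split_ifs with h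
    · simp [h]
    · simp only [h, false_and, iff_false]
      rintro rfl
      exact h hy
  have hmw := measurable_walk x k
  have hlaw : (jumpsLaw n).map (fun ω => ω k) = stepLaw n := by
    rw [jumpsLaw]; exact Measure.infinitePi_map_eval _ k
  rw [hset, ← Measure.map_apply (hmw.prodMk (measurable_pi_apply k)) hmA,
    (indepFun_iff_map_prod_eq_prod_map_map hmw.aemeasurable
      (measurable_pi_apply k).aemeasurable).1 (indepFun_walk_jump n x k), hlaw,
    Measure.prod_apply_symm hmA, stepLaw, lintegral_finsetSum_measure]
  refine Finset.sum_congr rfl fun s _ => ?_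
  rw [lintegral_smul_measure, lintegral_dirac, smul_eq_mul,
    Measure.map_apply hmw MeasurableSet.of_discrete]
  rfl

lemma jumpsLaw_walk_eq {n : ℕ} (hn : 3 ≤ n) {x : ℤ × ℤ} (hx : x ∈ quadrant) (k : ℕ) {y : ℤ × ℤ}
    (hy : y ∈ quadrant) : jumpsLaw n {ω | walk x ω k = y} = ENNReal.ofReal
      ((killed (Real.sin (Real.pi / n) ^ 2 / 2) (Real.cos (Real.pi / n) ^ 2 / 2) ^ k)
        (pointMass x) y) := by
  induction k generalizing y with
  | zero =>
    by_cases h : y = x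
    · subst h
      simp [walk, pointMass_self hx]
    · simp [walk, pointMass_of_ne h, Ne.symm h]
  | succ k ih =>
    obtain ⟨ha, hb⟩ := sin_pos_cos_pos hn
    set a := Real.sin (Real.pi / n) ^ 2 / 2
    set b := Real.cos (Real.pi / n) ^ 2 / 2
    set u := (killed a b ^ k) (pointMass x) with hu
    have hpow : ∀ z, 0 ≤ u z := killed_pow_nonneg ha hb (pointMass_nonneg x) k
    have hset : ∀ s : ℤ × ℤ, jumpsLaw n {ω | walk x ω k ∈ quadrant ∧ walk x ω k + s = y}
        = ENNReal.ofReal (u (y - s)) := by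
      intro s
      by_cases hs : y - s ∈ quadrant
      · rw [← ih hs]
        congr 1
        ext ω
        simp only [Set.mem_ofPred_eq, eq_sub_iff_add_eq]
        exact ⟨fun h => h.2, fun h => ⟨by rw [← h, add_sub_cancel_right] at hs; exact hs, h⟩⟩
      · rw [hu, killed_pow_of_notMem _ (fun z hz => pointMass_of_notMem hz) hs, ENNReal.ofReal_zero]
        convert measure_empty (μ := jumpsLaw n)
        ext ω
        simp only [Set.mem_ofPred_eq, Set.mem_empty_iff_false, iff_false, not_and]
        rintro h rfl
        exact hs (by rwa [add_sub_cancel_right])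
    have h1 := hpow (y.1 + 1, y.2)
    have h2 := hpow (y.1 - 1, y.2)
    have h3 := hpow (y.1 + 1, y.2 - 1)
    have h4 := hpow (y.1 - 1, y.2 + 1)
    rw [jumpsLaw_walk_succ n x k hy, sum_steps, hset, hset, hset, hset, stepProb_right,
      stepProb_left, stepProb_down, stepProb_up, killed_pow_succ, killed_of_mem hy, nbrAvg, ← hu]
    simp only [Prod.sub_def, sub_zero, sub_neg_eq_add]
    rw [← ENNReal.ofReal_mul ha.le, ← ENNReal.ofReal_mul ha.le, ← ENNReal.ofReal_mul hb.le,
      ← ENNReal.ofReal_mul hb.le, ← ENNReal.ofReal_add, ← ENNReal.ofReal_add, ← ENNReal.ofReal_add]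
    · congr 1
      ring
    all_goals positivity

lemma green_eq {n : ℕ} (hn : 3 ≤ n) (x y : quadrant) : green n x y = ENNReal.ofReal
    (greenSum (Real.sin (Real.pi / n) ^ 2 / 2) (Real.cos (Real.pi / n) ^ 2 / 2) y x) := by
  classical
  obtain ⟨ha, hb⟩ := sin_pos_cos_pos hn
  have hab := two_mul_sin_add_two_mul_cos n
  have hmeas : ∀ k, MeasurableSet {ω : ℕ → ℤ × ℤ | walk x ω k = (y : ℤ × ℤ)} := fun k =>
    measurable_walk x k (measurableSet_singleton _)
  have hind : ∀ k, (fun ω : ℕ → ℤ × ℤ => if walk (x : ℤ × ℤ) ω k = (y : ℤ × ℤ) then (1 : ENNReal)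
      else 0) = {ω | walk x ω k = (y : ℤ × ℤ)}.indicator 1 := by
    intro k
    ext ω
    simp [Set.indicator_apply]
  rw [green, lintegral_tsum, greenSum, ENNReal.ofReal_tsum_of_nonneg]
  · refine tsum_congr fun k => ?_
    rw [killed_pow_pointMass_comm, ← jumpsLaw_walk_eq hn x.2 k y.2,
      ← lintegral_indicator_one (hmeas k),
      ← hind k]
  · exact fun k => killed_pow_nonneg ha hb (pointMass_nonneg _) k _
  · exact summable_killed_pow_pointMass ha hb hab _ _
  · intro k
    have : AEMeasurable (fun ω : ℕ → ℤ × ℤ => if walk (x : ℤ × ℤ) ω k = (y : ℤ × ℤ)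
        then (1 : ENNReal) else 0) (jumpsLaw n) := by
      rw [hind k]
      exact (measurable_one.indicator (hmeas k)).aemeasurable
    convert this

/-! ### Convergence of the Martin kernels -/

lemma isHarmonic_iff {n : ℕ} {h : quadrant → ℝ} : IsHarmonic n h ↔ IsKilledHarmonic
    (Real.sin (Real.pi / n) ^ 2 / 2) (Real.cos (Real.pi / n) ^ 2 / 2) (extendZero h) := by
  constructor
  · refine fun hh => ⟨fun z hz => extendZero_of_notMem hz, fun z hz => ?_⟩
    rw [← sum_stepProb_mul, extendZero_of_mem hz]
    exact (hh ⟨z, hz⟩).symm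
  · intro hh x
    rw [sum_stepProb_mul, hh.harmonic x x.2, extendZero_of_mem x.2]

lemma f_pos {n : ℕ} (hn : 3 ≤ n) {z : ℤ × ℤ} (hz : z ∈ quadrant) : 0 < f n z := by
  obtain ⟨N, c, C, hF⟩ := exists_isProfile hn
  have h1 : (1 : ℝ) ≤ z.1 := by exact_mod_cast hz.1
  have h2 : (1 : ℝ) ≤ z.2 := by exact_mod_cast hz.2
  have hc := hF.c_pos
  have := hF.lower z hz
  rw [extendZero_of_mem hz] at this
  exact lt_of_lt_of_le (by positivity) this

/-- Any limit of the Martin kernels at infinity is a positive harmonic function, as the Green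
function with target `y` is harmonic off `y`; hence it is a multiple of `f`. -/
lemma tendsto_martinKernel {n : ℕ} (hn : 3 ≤ n) (x₀ x : quadrant) :
    Tendsto (fun y => martinKernel n x₀ x y) cofinite (𝓝 (f n x / f n x₀)) := by
  obtain ⟨ha, hb⟩ := sin_pos_cos_pos hn
  have hab := two_mul_sin_add_two_mul_cos n
  obtain ⟨N, c, C, hF⟩ := exists_isProfile hn
  have hmk : ∀ x y : quadrant, martinKernel n x₀ x y =
      greenSum (Real.sin (Real.pi / n) ^ 2 / 2) (Real.cos (Real.pi / n) ^ 2 / 2) y x /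
      greenSum (Real.sin (Real.pi / n) ^ 2 / 2) (Real.cos (Real.pi / n) ^ 2 / 2) y x₀ := by
    intro x y
    rw [martinKernel, green_eq hn, green_eq hn, ENNReal.toReal_ofReal (greenSum_nonneg ha hb _ _),
      ENNReal.toReal_ofReal (greenSum_nonneg ha hb _ _)]
  simp only [hmk]
  set a := Real.sin (Real.pi / n) ^ 2 / 2
  set b := Real.cos (Real.pi / n) ^ 2 / 2
  rw [tendsto_iff_ultrafilter]
  intro U hU
  have hG0 : ∀ y : quadrant, 0 < greenSum a b y x₀ := fun y => greenSum_pos ha hb hab y.2 x₀.2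
  have hbdd : ∀ z : ℤ × ℤ, ∃ B : ℝ, ∀ y : quadrant,
      greenSum a b y z / greenSum a b y x₀ ∈ Set.Icc 0 B := by
    intro z
    by_cases hz : z ∈ quadrant
    · obtain ⟨c, hc, hle⟩ := exists_harnack ha hb x₀.2 hz
      refine ⟨1 / c, fun y => ⟨div_nonneg (greenSum_nonneg ha hb _ _) (hG0 y).le, ?_⟩⟩
      rw [div_le_div_iff₀ (hG0 y) hc, one_mul, mul_comm]
      exact hle _ (isPosSuper_greenSum ha hb hab y)
    · exact ⟨0, fun y => by rw [greenSum_of_notMem _ hz, zero_div]; simp⟩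
  have hlim : ∀ z : ℤ × ℤ, ∃ l : ℝ, 0 ≤ l ∧
      Tendsto (fun y : quadrant => greenSum a b y z / greenSum a b y x₀) U (𝓝 l) := by
    intro z
    obtain ⟨B, hB⟩ := hbdd z
    obtain ⟨l, hl, hle⟩ := isCompact_Icc.ultrafilter_le_nhds
      (U.map fun y : quadrant => greenSum a b y z / greenSum a b y x₀)
      (by rw [Ultrafilter.coe_map, le_principal_iff, mem_map]; exact univ_mem' hB)
    exact ⟨l, hl.1, hle⟩
  choose l hl0 hl using hlim
  have hharm : IsKilledHarmonic a b l := by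
    refine ⟨fun z hz => ?_, fun z hz => ?_⟩
    · refine tendsto_nhds_unique (hl z) (tendsto_const_nhds.congr fun y => ?_)
      rw [greenSum_of_notMem _ hz, zero_div]
    · have h1 : Tendsto (fun y : quadrant =>
          nbrAvg a b (fun w => greenSum a b y w / greenSum a b y x₀) z) U (𝓝 (nbrAvg a b l z)) := by
        simp only [nbrAvg]
        exact ((((hl _).const_mul a).add ((hl _).const_mul a)).add ((hl _).const_mul b)).add
          ((hl _).const_mul b)
      refine tendsto_nhds_unique h1 ((hl z).congr' ?_)
      have hne : ∀ᶠ y in (U : Filter quadrant), y ≠ ⟨z, hz⟩ :=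
        hU (Set.finite_singleton _).compl_mem_cofinite
      filter_upwards [hne] with y hy
      have : z ≠ y := fun h => hy (Subtype.ext h.symm)
      rw [greenSum_eq ha hb hab _ hz, pointMass_of_ne this]
      simp only [nbrAvg]
      ring
  have huniq := hF.eq_of_nonneg ha hb hab hharm hl0
  have hone : l x₀ = 1 :=
    tendsto_nhds_unique (hl x₀) (tendsto_const_nhds.congr fun y => (div_self (hG0 y).ne').symm)
  have hfx : ∀ y : quadrant, l y = l (1, 1) / extendZero (fun x => f n x) (1, 1) * f n y := by
    intro y
    rw [huniq y, extendZero_of_mem y.2]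
  have hlx : l x = f n x / f n x₀ := by
    have h0 := hfx x₀
    rw [hone] at h0
    rw [hfx x, eq_div_iff (f_pos hn x₀.2).ne', mul_right_comm, ← h0, one_mul]
  rw [← hlx]
  exact hl x

/-! ### The one-point compactification -/

instance infinite_quadrant : Infinite quadrant :=
  Infinite.of_injective (fun k : ℕ =>
    (⟨((k : ℤ) + 1, 1), by constructor <;> dsimp only <;> omega⟩ : quadrant))
    fun k l h => by
      have := congr_arg (fun x : quadrant => (x : ℤ × ℤ).1) h
      simpa using this

/-- A discrete dense subspace of a Hausdorff space consists of isolated points of it. -/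
lemma isOpen_singleton_of_isDenseEmbedding {X K : Type*} [TopologicalSpace X] [DiscreteTopology X]
    [TopologicalSpace K] [T2Space K] {ι : X → K} (hι : IsDenseEmbedding ι) (y : X) :
    IsOpen {ι y} := by
  obtain ⟨U, hU, hUy⟩ := hι.isInducing.isOpen_iff.1 (isOpen_discrete {y})
  have hyU : ι y ∈ U := by
    have : y ∈ ι ⁻¹' U := by rw [hUy]; rfl
    exact this
  have hsub : U ⊆ {ι y} := by
    by_contra hcon
    obtain ⟨p, hpU, hp⟩ := Set.not_subset.1 hcon
    obtain ⟨w, hw⟩ := hι.dense.exists_mem_open (hU.inter isClosed_singleton.isOpen_compl)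
      ⟨p, hpU, hp⟩
    have hwy : w ∈ ι ⁻¹' U := hw.1
    rw [hUy] at hwy
    exact hw.2 (by rw [Set.mem_singleton_iff.1 hwy]; rfl)
  rwa [← hsub.antisymm (Set.singleton_subset_iff.2 hyU)]

open Classical in
/-- Every Hausdorff space in which a discrete space embeds densely maps continuously to the
one-point compactification. -/
lemma exists_continuous_onePoint {X K : Type*} [TopologicalSpace X] [DiscreteTopology X]
    [TopologicalSpace K] [T2Space K] {ι : X → K} (hι : IsDenseEmbedding ι) :
    ∃ π : K → OnePoint X, Continuous π ∧ ∀ y, π (ι y) = (y : OnePoint X) := by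
  set π : K → OnePoint X := fun p =>
    if h : ∃ y, ι y = p then (h.choose : OnePoint X) else OnePoint.infty
    with hπ
  have hπι : ∀ y, π (ι y) = (y : OnePoint X) := by
    intro y
    have h : ∃ y', ι y' = ι y := ⟨y, rfl⟩
    simp only [hπ]
    rw [dif_pos h, hι.injective h.choose_spec]
  have hπinf : ∀ p, (∀ y, ι y ≠ p) → π p = OnePoint.infty := by
    intro p hp
    simp only [hπ]
    exact dif_neg fun ⟨y, hy⟩ => hp y hy
  refine ⟨π, continuous_def.2 fun S hS => ?_, hπι⟩
  by_cases hinf : OnePoint.infty ∈ S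
  · have hfin : ((↑) ⁻¹' S : Set X)ᶜ.Finite :=
      ((OnePoint.isOpen_iff_of_mem hinf).1 hS).2.finite_of_discrete
    have e : π ⁻¹' S = (ι '' ((↑) ⁻¹' S : Set X)ᶜ)ᶜ := by
      ext p
      by_cases hp : ∃ y, ι y = p
      · obtain ⟨y, rfl⟩ := hp
        simp only [Set.mem_preimage, hπι, Set.mem_compl_iff, hι.injective.mem_set_image, not_not]
      · have h1 : π p = OnePoint.infty := hπinf p fun y hy => hp ⟨y, hy⟩
        simp only [Set.mem_preimage, h1, hinf, true_iff, Set.mem_compl_iff]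
        rintro ⟨y, -, hy⟩
        exact hp ⟨y, hy⟩
    rw [e]
    exact (hfin.image ι).isClosed.isOpen_compl
  · have e : π ⁻¹' S = ⋃ y ∈ ((↑) ⁻¹' S : Set X), {ι y} := by
      ext p
      by_cases hp : ∃ y, ι y = p
      · obtain ⟨y, rfl⟩ := hp
        simp [hπι, hι.injective.eq_iff]
      · have h1 : π p = OnePoint.infty := hπinf p fun y hy => hp ⟨y, hy⟩
        simp only [Set.mem_preimage, h1, hinf, false_iff, Set.mem_iUnion, Set.mem_singleton_iff]
        rintro ⟨y, -, hy⟩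
        exact hp ⟨y, hy.symm⟩
    rw [e]
    exact isOpen_biUnion fun y _ => isOpen_singleton_of_isDenseEmbedding hι y

lemma isMartinCompactification_onePoint {n : ℕ} (hn : 3 ≤ n) (x₀ : quadrant) :
    IsMartinCompactification n x₀ (OnePoint quadrant) (fun x => (x : OnePoint quadrant)) where
  compact := inferInstance
  hausdorff := inferInstance
  isDenseEmbedding := by
    have : NoncompactSpace quadrant := ⟨fun h => Set.infinite_univ h.finite_of_discrete⟩
    exact OnePoint.isDenseEmbedding_coe
  extend x := by
    refine ⟨fun p => p.elim (f n x / f n x₀) (martinKernel n x₀ x), ?_, fun y => rfl⟩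
    rw [OnePoint.continuous_iff_from_discrete]
    exact tendsto_martinKernel hn x₀ x
  smallest K' _ ι' h' := by
    have := h'.hausdorff
    exact exists_continuous_onePoint h'.isDenseEmbedding

end KilledWalk

end

theorem mainTheorem2 (n : ℕ) (hn : 3 ≤ n) :
    -- the Green functions are positive and finite (transience), so the Martin kernels make sense
    (∀ x y : KilledWalk.quadrant, 0 < KilledWalk.green n x y ∧ KilledWalk.green n x y < ⊤) ∧
    -- the Martin compactification is the one-point compactification
    (∀ x₀ : KilledWalk.quadrant,
      KilledWalk.IsMartinCompactification n x₀ (OnePoint KilledWalk.quadrant)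
        (fun x => (x : OnePoint KilledWalk.quadrant))) ∧
    -- `f_n` is a positive harmonic function
    (∀ x : KilledWalk.quadrant, 0 < KilledWalk.f n x) ∧
    KilledWalk.IsHarmonic n (fun x => KilledWalk.f n x) ∧
    -- and it is the only one up to a positive constant
    (∀ h : KilledWalk.quadrant → ℝ, KilledWalk.IsHarmonic n h → (∀ x, 0 ≤ h x) → (∃ x, h x ≠ 0) →
      ∃ c : ℝ, 0 < c ∧ ∀ x : KilledWalk.quadrant, h x = c * KilledWalk.f n x) := by
  obtain ⟨ha, hb⟩ := KilledWalk.sin_pos_cos_pos hn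
  have hab := KilledWalk.two_mul_sin_add_two_mul_cos n
  obtain ⟨N, c, C, hF⟩ := KilledWalk.exists_isProfile hn
  refine ⟨fun x y => ?_, KilledWalk.isMartinCompactification_onePoint hn,
    fun x => KilledWalk.f_pos hn x.2, KilledWalk.isHarmonic_iff.2 ⟨hF.zero, hF.harmonic⟩,
    fun h hh hnn ⟨w, hw⟩ => ?_⟩
  · rw [KilledWalk.green_eq hn]
    exact ⟨ENNReal.ofReal_pos.2 (KilledWalk.greenSum_pos ha hb hab y.2 x.2), ENNReal.ofReal_lt_top⟩
  · have hnn' : ∀ z, 0 ≤ KilledWalk.extendZero h z := by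
      intro z
      by_cases hz : z ∈ KilledWalk.quadrant
      · rw [KilledWalk.extendZero_of_mem hz]; exact hnn _
      · rw [KilledWalk.extendZero_of_notMem hz]
    have huniq : ∀ x : KilledWalk.quadrant, h x = KilledWalk.extendZero h (1, 1) /
        KilledWalk.extendZero (fun x => KilledWalk.f n x) (1, 1) * KilledWalk.f n x := by
      intro x
      have := hF.eq_of_nonneg ha hb hab (KilledWalk.isHarmonic_iff.1 hh) hnn' x
      rwa [KilledWalk.extendZero_of_mem x.2, KilledWalk.extendZero_of_mem x.2] at this
    refine ⟨_, ?_, huniq⟩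
    have h1 : 0 < h w := (hnn w).lt_of_ne' hw
    rw [huniq w] at h1
    exact pos_of_mul_pos_left h1 (KilledWalk.f_pos hn w.2).le
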